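/- For a finite Borel measure $\eta$ on $\mathbb R$ with finite first moment put $P_\eta(k)=\int (k-x)^+\,\eta(dx)$ and $C_\eta(k)=\int (x-k)^+\,\eta(dx)$. Write $\eta\le_{cd}\chi$ if $\int f\,d\eta\le\int f\,d\chi$ for all convex non-increasing $f:\mathbb R\to\mathbb R$, and $\eta\le\chi$ if $\eta(A)\le\chi(A)$ for all Borel $A$. The shadow $S^\chi(\eta)$ is the smallest element, with respect to $\le_{cd}$, of the set of finite measures $\theta$ with finite first moment and $\eta\le_{cd}\theta\le\chi$. The convex hull $f^c$ of $f:\mathbb R\to\mathbb R$ is the largest convex function below $f$. Let $\mu,\nu$ be Borel probability measures on $\mathbb R$ with finite first moments and $\mu\le_{cd}\nu$. Let $G(p)=\inf\{k\in\mathbb R:\mu((-\infty,k])>p\}\in[-\infty,\infty]$, $p\in[0,1]$, be the right-continuous quantile function of $\mu$. For $u\in[0,1]$ let $$\mu_u=\mu|_{(G(1-u),\infty)}+\big(u-\mu((G(1-u),\infty))\big)\delta_{G(1-u)},\qquad T(u)=\operatorname{supp}\big(\nu-S^\nu(\mu_u)\big),$$ $$\mathcal E_u=P_\nu-P_\mu+C_\mu-C_{\mu_u},$$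 where the atom in $\mu_u$ is absent if $G(1-u)=\pm\infty$ (its mass is then $0$). If $G(1-u)$ is finite, let $\phi(u)=\sup\partial\mathcal E_u^c(G(1-u))$ be the largest slope of a supporting line of $\mathcal E_u^c$ at $G(1-u)$ and let $L_u(k)=\mathcal E_u^c(G(1-u))+\phi(u)(k-G(1-u))$; if $G(1-u)=\pm\infty$ (which can happen only for $u=0$, respectively $u=1$), let $L_u$ be the constant $\lim_{k\to\pm\infty}\mathcal E_u^c(k)$. Define $$R(u)=\inf\{k\in\mathbb R:k\le G(1-u),\ \mathcal E_u^c(k)=L_u(k)\},\qquad S(u)=\sup\{k\in\mathbb R:k\ge G(1-u),\ \mathcal E_u^c(k)=L_u(k)\}$$ in $[-\infty,\infty]$, except that $R(u)=-\infty$ if $G(1-u)=-\infty$ and $S(u)=\infty$ if $G(1-u)=\infty$; here $\inf\emptyset=\infty$ and $\sup\emptyset=-\infty$. Then: 1. $R(u)\le G(1-u)\le S(u)$ for all $u\in[0,1]$; 2. $R$ is non-increasing on $[0,1]$; 3. for all $u,v\in[0,1]$ with $u<v$, $S(v)\notin(R(u),S(u))$; 4. for all $u,v\in[0,1]$ with $u<v$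 and $S(u)=\infty$, $\ \sup T(v)\le\sup T(u)=R(u)$. -/

import Mathlib

open MeasureTheory Filter Set

noncomputable section

namespace ShadowCoupling

/-! ### Measures with finite first moment, stochastic order, shadow -/

/-- The class of positive Borel measures on the line with finite mass and finite first moment. -/
def FiniteFirstMoment (η : Measure ℝ) : Prop :=
  IsFiniteMeasure η ∧ Integrable (fun x : ℝ => x) η

/-- The convex-decreasing order: `∫ f dη ≤ ∫ f dχ` for all convex non-increasing `f : ℝ → ℝ`.
The inequality is required of those `f` for which both integrals are finite; the constants `1`
and `-1` are among them, so the two measures have the same mass. -/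
def ConvexDecreasingLE (η χ : Measure ℝ) : Prop :=
  ∀ f : ℝ → ℝ, ConvexOn ℝ univ f → Antitone f → Integrable f η → Integrable f χ →
    ∫ x, f x ∂η ≤ ∫ x, f x ∂χ

/-- The measures `θ` with finite first moment such that `η ≤_cd θ ≤ χ`. -/
def targets (η χ : Measure ℝ) : Set (Measure ℝ) :=
  {θ | FiniteFirstMoment θ ∧ ConvexDecreasingLE η θ ∧ θ ≤ χ}

/-- `σ` is the smallest element of `targets η χ` for the convex-decreasing order. -/
def IsShadow (η χ σ : Measure ℝ) : Prop :=
  σ ∈ targets η χ ∧ ∀ θ ∈ targets η χ, ConvexDecreasingLE σ θ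

open Classical in
/-- The shadow `S^χ(η)` of `η` in `χ`. -/
def shadow (η χ : Measure ℝ) : Measure ℝ :=
  if h : ∃ σ, IsShadow η χ σ then h.choose else 0

/-! ### Potential functions, convex hull -/

/-- `P_η(k) = ∫ (k - x)^+ η(dx)`. -/
def putPotential (η : Measure ℝ) (k : ℝ) : ℝ := ∫ x, max (k - x) 0 ∂η

/-- `C_η(k) = ∫ (x - k)^+ η(dx)`. -/
def callPotential (η : Measure ℝ) (k : ℝ) : ℝ := ∫ x, max (x - k) 0 ∂η

/-- The convex hull `f^c`: the largest convex function below `f` (for `f` that has a convex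
minorant). -/
def convexEnvelope (f : ℝ → ℝ) (k : ℝ) : ℝ :=
  sSup {y | ∃ h : ℝ → ℝ, ConvexOn ℝ univ h ∧ (∀ x, h x ≤ f x) ∧ y = h k}

/-- The subdifferential of `f` at `x`. -/
def subdifferential (f : ℝ → ℝ) (x : ℝ) : Set ℝ :=
  {ψ | ∀ y, f x + ψ * (y - x) ≤ f y}

/-! ### The decreasing quantile lift -/

/-- The right-continuous quantile function `G(p) = inf {k : μ((-∞, k]) > p}`, with values in
`[-∞, ∞]`. -/
def quantile (μ : Measure ℝ) (p : ℝ) : EReal :=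
  sInf (Real.toEReal '' {k : ℝ | p < μ.real (Iic k)})

/-- The mass `u` of `μ` that lies furthest to the right: `μ` restricted to `(G(1-u), ∞)` together
with the missing mass `u - μ((G(1-u), ∞))` at `G(1-u)`. When `μ` is a probability measure,
`0 ≤ u ≤ 1` and `G(1-u)` is infinite, the missing mass is `0`. -/
def upperPart (μ : Measure ℝ) (u : ℝ) : Measure ℝ :=
  μ.restrict {x : ℝ | quantile μ (1 - u) < (x : EReal)} +
    ENNReal.ofReal (u - μ.real {x : ℝ | quantile μ (1 - u) < (x : EReal)}) •
      Measure.dirac (quantile μ (1 - u)).toReal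

/-- `D = P_ν - P_μ`. -/
def potentialGap (μ ν : Measure ℝ) (k : ℝ) : ℝ := putPotential ν k - putPotential μ k

/-- `𝓔_u = D + C_μ - C_{μ_u}`. -/
def calE (μ ν : Measure ℝ) (u k : ℝ) : ℝ :=
  potentialGap μ ν k + callPotential μ k - callPotential (upperPart μ u) k

/-- `𝓔_u^c`. -/
def calEHull (μ ν : Measure ℝ) (u : ℝ) : ℝ → ℝ := convexEnvelope (calE μ ν u)

/-- `φ(u) = sup ∂𝓔_u^c(G(1-u))`, the largest slope of a supporting line of `𝓔_u^c` at
`G(1-u)` (when `G(1-u)` is finite). -/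
def phi (μ ν : Measure ℝ) (u : ℝ) : ℝ :=
  sSup (subdifferential (calEHull μ ν u) (quantile μ (1 - u)).toReal)

/-- The line through `(G(1-u), 𝓔_u^c(G(1-u)))` with slope `φ(u)`. When `G(1-u) = ±∞` (possible
for `0 ≤ u ≤ 1` only at `u = 0` and at `u = 1` respectively) it is the horizontal asymptote
of `𝓔_u^c` there. -/
def supportLine (μ ν : Measure ℝ) (u k : ℝ) : ℝ :=
  if quantile μ (1 - u) = ⊤ then limUnder atTop (calEHull μ ν u)
  else if quantile μ (1 - u) = ⊥ then limUnder atBot (calEHull μ ν u)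
  else calEHull μ ν u (quantile μ (1 - u)).toReal
    + phi μ ν u * (k - (quantile μ (1 - u)).toReal)

/-- `R(u) = inf {k ≤ G(1-u) : 𝓔_u^c = supporting line at k}`, and `-∞` if `G(1-u) = -∞`. -/
def lowerFn (μ ν : Measure ℝ) (u : ℝ) : EReal :=
  if quantile μ (1 - u) = ⊥ then ⊥
  else sInf (Real.toEReal '' {k : ℝ | (k : EReal) ≤ quantile μ (1 - u) ∧
    calEHull μ ν u k = supportLine μ ν u k})

/-- `S(u) = sup {k ≥ G(1-u) : 𝓔_u^c = supporting line at k}`, and `∞` if `G(1-u) = ∞`. -/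
def upperFn (μ ν : Measure ℝ) (u : ℝ) : EReal :=
  if quantile μ (1 - u) = ⊤ then ⊤
  else sSup (Real.toEReal '' {k : ℝ | quantile μ (1 - u) ≤ (k : EReal) ∧
    calEHull μ ν u k = supportLine μ ν u k})

/-- `T(u)`, the support of `ν - S^ν(μ_u)`. -/
def remainingSupport (μ ν : Measure ℝ) (u : ℝ) : Set ℝ :=
  (ν - shadow (upperPart μ u) ν).support

end ShadowCoupling

end

/-!
# The shape of the bounds of the decreasing shadow coupling

Write `h_u` for the hull `𝓔_u^c`, `G` for the quantile function and `A_u` for the contact set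
`{h_u = L_u}`. The bounds `R(u) ≤ G(1-u) ≤ S(u)` hold because `G(1-u) ∈ A_u` when it is finite. The
other claims rest on one fact:
for `u < v`, the function `h_v` is affine between any two points of `A_u`
(`calEHull_affine_on_of_contact`). Indeed `𝓔_v = 𝓔_u - ψ`, where `ψ = C_{μ_v} - C_{μ_u}` is convex
because `μ_u ≤ μ_v`. Where `h_u` is affine, the chord of `h_v`, increased by `ψ`, stays below `h_u`,
so that `h_v` may be replaced by that chord (`convexEnvelope_sub_affine_on`, with the gluing lemma
`convexOn_ite_Icc`).

*Monotonicity of `R`.* It suffices that every `a ∈ A_u` with `a < G(1-v)` lies in `A_v`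
(`contact_of_lt_quantile`). If `A_u` also has a point to the right of `G(1-v)`, then `h_v` is affine
around `G(1-v)` and hence equal to its support line there. Otherwise `G(1-v) = G(1-u)`, the function
`ψ` is a multiple of the put payoff with strike `G(1-u)`, and one has to see that `h_v` has no kink at the strike
(`convexEnvelope_sub_put_eq`).

*The position of `S(v)`.* If `R(u) < S(v) < S(u)`, then `h_v` is affine between a point of `A_u` to
the left of `S(v)` and one to the right of it, and the contact set of `h_v` would extend beyond
`S(v)`.

*The supports.* For convex `f` and `g`, the function `f - (f - g)^c` is convex
(`convexOn_sub_convexEnvelope_sub`). Hence `(P_ν - P_η)^c` and `P_ν - (P_ν - P_η)^c` are put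
potentials of two measures with sum `ν`, and the second one is the shadow of `η`
(`exists_isShadow`). This uses that a convex function of linear growth which tends to `0` at `-∞` is
a put potential (`exists_measure_putPotential_eq`), that put potentials determine the measure
(`measure_eq_of_putPotential_eq`), and that, for equal masses, they determine the convex-decreasing
order (`convexDecreasingLE_of_putPotential_le`). It follows that the call potential of
`ν - S^ν(μ_u)` is `h_u` up to a constant, and the upper end of `T(u)` is the left end of the
half-line on which `h_u` is affine, which is `R(u)` if `S(u) = ∞`.
-/

namespace ShadowCoupling

/-! ### Convex functions on the line and convex hulls -/

theorem chord_of_convexOn {S : Set ℝ} {f : ℝ → ℝ} (hf : ConvexOn ℝ S f) {x y z : ℝ}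
    (hx : x ∈ S) (hz : z ∈ S) (hxy : x ≤ y) (hyz : y ≤ z) :
    (z - x) * f y ≤ (z - y) * f x + (y - x) * f z := by
  rcases eq_or_lt_of_le (hxy.trans hyz) with h | h
  · have h1 : y = x := le_antisymm (by linarith) hxy
    subst h1; subst h; simp
  have hp : 0 < z - x := by linarith
  have := hf.2 hx hz (div_nonneg (sub_nonneg.2 hyz) hp.le) (div_nonneg (sub_nonneg.2 hxy) hp.le)
    (show (z - y) / (z - x) + (y - x) / (z - x) = 1 by field_simp; ring)
  have e : (z - y) / (z - x) * x + (y - x) / (z - x) * z = y := by field_simp; ring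
  simp only [smul_eq_mul] at this
  rw [e] at this
  have h2 := mul_le_mul_of_nonneg_left this hp.le
  calc (z - x) * f y ≤ _ := h2
    _ = _ := by field_simp

theorem convexOn_of_chord {f : ℝ → ℝ}
    (h : ∀ x y z : ℝ, x < y → y < z → (z - x) * f y ≤ (z - y) * f x + (y - x) * f z) :
    ConvexOn ℝ univ f := by
  refine LinearOrder.convexOn_of_lt convex_univ ?_
  intro x _ z _ hxz a b ha hb hab
  simp only [smul_eq_mul]
  have hb' : b = 1 - a := by linarith
  have hp : 0 < z - x := by linarith
  have := h x (a * x + b * z) z (by subst hb'; nlinarith) (by subst hb'; nlinarith)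
  refine le_of_mul_le_mul_left (this.trans (le_of_eq ?_)) hp
  subst hb'; ring

/-- Raising a convex function on `[a, b]` to a larger convex function with the same end values
keeps it convex. -/
theorem convexOn_ite_Icc {h p : ℝ → ℝ} {a b : ℝ} (hab : a ≤ b) (hh : ConvexOn ℝ univ h)
    (hp : ConvexOn ℝ (Icc a b) p) (hle : ∀ x ∈ Icc a b, h x ≤ p x) (ha : p a = h a)
    (hb : p b = h b) : ConvexOn ℝ univ (fun x => if x ∈ Icc a b then p x else h x) := by
  set q : ℝ → ℝ := fun x => if x ∈ Icc a b then p x else h x with hq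
  have hhq : ∀ x, h x ≤ q x := by
    intro x
    by_cases hx : x ∈ Icc a b
    · simpa only [hq, if_pos hx] using hle x hx
    · simp only [hq, if_neg hx, le_refl]
  have q_in : ∀ x ∈ Icc a b, q x = p x := fun x hx => by simp only [hq, if_pos hx]
  have q_le : ∀ x, x ≤ a ∨ b ≤ x → q x = h x := by
    intro x hx
    by_cases hx' : x ∈ Icc a b
    · rw [q_in x hx']
      rcases hx with hx | hx
      · rw [le_antisymm hx hx'.1, ha]
      · rw [le_antisymm hx'.2 hx, hb]
    · simp only [hq, if_neg hx']
  have outer : ∀ x y z, x ≤ y → y ≤ z → (y ≤ a ∨ b ≤ y) →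
      (z - x) * q y ≤ (z - y) * q x + (y - x) * q z := by
    intro x y z hxy hyz hy
    rw [q_le y hy]
    have h1 := chord_of_convexOn hh (mem_univ x) (mem_univ z) hxy hyz
    have h2 := mul_le_mul_of_nonneg_left (hhq x) (sub_nonneg.2 hyz)
    have h3 := mul_le_mul_of_nonneg_left (hhq z) (sub_nonneg.2 hxy)
    linarith
  refine convexOn_of_chord fun x y z hxy hyz => ?_
  by_cases hy : y ≤ a ∨ b ≤ y
  · exact outer x y z hxy.le hyz.le hy
  push Not at hy
  -- Compare first on the part of `[x, z]` inside `[a, b]`, then move its end points out.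
  have hx' : ∃ x', x ≤ x' ∧ x' < y ∧ x' ∈ Icc a b ∧
      (z - x) * q x' ≤ (z - x') * q x + (x' - x) * q z := by
    rcases le_total x a with h | h
    · exact ⟨a, h, hy.1, ⟨le_rfl, hab⟩, outer x a z h (by linarith) (Or.inl le_rfl)⟩
    · exact ⟨x, le_rfl, hxy, ⟨h, by linarith⟩, by linarith⟩
  have hz' : ∃ z', z' ≤ z ∧ y < z' ∧ z' ∈ Icc a b ∧
      (z - x) * q z' ≤ (z - z') * q x + (z' - x) * q z := by
    rcases le_total b z with h | h
    · exact ⟨b, h, hy.2, ⟨hab, le_rfl⟩, outer x b z (by linarith) h (Or.inr le_rfl)⟩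
    · exact ⟨z, le_rfl, hyz, ⟨by linarith, h⟩, by linarith⟩
  obtain ⟨x', h1, h2, h3, h4⟩ := hx'
  obtain ⟨z', k1, k2, k3, k4⟩ := hz'
  have hc := chord_of_convexOn hp h3 k3 h2.le k2.le
  rw [← q_in _ h3, ← q_in _ k3, ← q_in y ⟨hy.1.le, hy.2.le⟩] at hc
  have e1 := mul_le_mul_of_nonneg_left h4 (sub_nonneg.2 k2.le)
  have e2 := mul_le_mul_of_nonneg_left k4 (sub_nonneg.2 h2.le)
  have e3 := mul_le_mul_of_nonneg_left hc (by linarith : 0 ≤ z - x)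
  refine le_of_mul_le_mul_left (a := z' - x') ?_ (by linarith)
  linear_combination e1 + e2 + e3

theorem convexOn_affine (S : Set ℝ) (hS : Convex ℝ S) (m c : ℝ) :
    ConvexOn ℝ S (fun x => m * x + c) := by
  refine ⟨hS, fun x _ y _ a b _ _ hab => le_of_eq ?_⟩
  simp only [smul_eq_mul]
  have : b = 1 - a := by linarith
  subst this; ring

/-- A convex function which is affine on an interval lies above the line extending it. -/
theorem affine_le_of_convexOn {f : ℝ → ℝ} (hf : ConvexOn ℝ univ f) {a b m c : ℝ} (hab : a < b)
    (h : ∀ x ∈ Icc a b, f x = m * x + c) (x : ℝ) : m * x + c ≤ f x := by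
  have ha := h a ⟨le_rfl, hab.le⟩
  have hb := h b ⟨hab.le, le_rfl⟩
  rcases le_total x a with hx | hx
  · have := chord_of_convexOn hf (mem_univ x) (mem_univ b) hx hab.le
    rw [ha, hb] at this
    refine le_of_mul_le_mul_left (a := b - a) ?_ (by linarith)
    linear_combination this
  rcases le_total b x with hx' | hx'
  · have := chord_of_convexOn hf (mem_univ a) (mem_univ x) hab.le hx'
    rw [ha, hb] at this
    refine le_of_mul_le_mul_left (a := b - a) ?_ (by linarith)
    linear_combination this
  · exact (h x ⟨hx, hx'⟩).ge

/-- A convex function above an affine one coincides with it between any two contact points. -/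
theorem eq_affine_of_contact {f : ℝ → ℝ} (hf : ConvexOn ℝ univ f) {a b m c : ℝ} (hab : a ≤ b)
    (hle : ∀ x, m * x + c ≤ f x) (ha : f a = m * a + c) (hb : f b = m * b + c) :
    ∀ x ∈ Icc a b, f x = m * x + c := by
  intro x hx
  refine le_antisymm ?_ (hle x)
  rcases eq_or_lt_of_le hab with h | h
  · subst h
    rw [le_antisymm hx.2 hx.1, ha]
  have := chord_of_convexOn hf (mem_univ a) (mem_univ b) hx.1 hx.2
  rw [ha, hb] at this
  refine le_of_mul_le_mul_left (a := b - a) ?_ (by linarith)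
  linear_combination this

theorem convexEnvelope_bddAbove (f : ℝ → ℝ) (k : ℝ) :
    BddAbove {y | ∃ h : ℝ → ℝ, ConvexOn ℝ univ h ∧ (∀ x, h x ≤ f x) ∧ y = h k} := by
  refine ⟨f k, ?_⟩
  rintro y ⟨h, -, hle, rfl⟩
  exact hle k

theorem le_convexEnvelope {f h : ℝ → ℝ} (hh : ConvexOn ℝ univ h) (hle : ∀ x, h x ≤ f x) (k : ℝ) :
    h k ≤ convexEnvelope f k :=
  le_csSup (convexEnvelope_bddAbove f k) ⟨h, hh, hle, rfl⟩

theorem convexEnvelope_le {f : ℝ → ℝ} (hf : ∃ h : ℝ → ℝ, ConvexOn ℝ univ h ∧ ∀ x, h x ≤ f x)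
    (k : ℝ) : convexEnvelope f k ≤ f k := by
  obtain ⟨h, hh, hle⟩ := hf
  refine csSup_le ⟨h k, h, hh, hle, rfl⟩ ?_
  rintro y ⟨h, -, hle, rfl⟩
  exact hle k

theorem convexOn_convexEnvelope {f : ℝ → ℝ}
    (hf : ∃ h : ℝ → ℝ, ConvexOn ℝ univ h ∧ ∀ x, h x ≤ f x) :
    ConvexOn ℝ univ (convexEnvelope f) := by
  refine ⟨convex_univ, fun x _ y _ a b ha hb hab => ?_⟩
  obtain ⟨h, hh, hle⟩ := hf
  refine csSup_le ⟨_, h, hh, hle, rfl⟩ ?_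
  rintro z ⟨h, hh, hle, rfl⟩
  refine (hh.2 (mem_univ x) (mem_univ y) ha hb hab).trans ?_
  simp only [smul_eq_mul]
  exact add_le_add (mul_le_mul_of_nonneg_left (le_convexEnvelope hh hle x) ha)
    (mul_le_mul_of_nonneg_left (le_convexEnvelope hh hle y) hb)

theorem convexEnvelope_eq_self {f : ℝ → ℝ} (hf : ConvexOn ℝ univ f) : convexEnvelope f = f :=
  funext fun k => le_antisymm (convexEnvelope_le ⟨f, hf, fun _ => le_rfl⟩ k)
    (le_convexEnvelope hf (fun _ => le_rfl) k)

theorem convexEnvelope_add_affine {f : ℝ → ℝ}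
    (hf : ∃ h : ℝ → ℝ, ConvexOn ℝ univ h ∧ ∀ x, h x ≤ f x) (m c k : ℝ) :
    convexEnvelope (fun x => f x + (m * x + c)) k = convexEnvelope f k + (m * k + c) := by
  have hf' : ∃ h : ℝ → ℝ, ConvexOn ℝ univ h ∧ ∀ x, h x ≤ f x + (m * x + c) := by
    obtain ⟨h, hh, hle⟩ := hf
    exact ⟨_, hh.add (convexOn_affine univ convex_univ m c), fun x => by
      simpa using hle x⟩
  refine le_antisymm ?_ ?_
  · have := le_convexEnvelope (f := f) ((convexOn_convexEnvelope hf').add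
      (convexOn_affine univ convex_univ (-m) (-c))) (fun x => by
        have := convexEnvelope_le hf' x
        simp only [Pi.add_apply]; linarith) k
    simp only [Pi.add_apply] at this
    linarith
  · exact le_convexEnvelope (f := fun x => f x + (m * x + c)) ((convexOn_convexEnvelope hf).add
      (convexOn_affine univ convex_univ m c)) (fun x => by
        have := convexEnvelope_le hf x
        simp only [Pi.add_apply]; linarith) k

/-- For convex `f` and `g`, the function `f - (f - g)^c` is convex: its chord on `[x, z]` lies
above it, as otherwise the hull could be raised on `[x, z]` to `f` minus that chord. -/
theorem convexOn_sub_convexEnvelope_sub {f g : ℝ → ℝ} (hf : ConvexOn ℝ univ f)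
    (hg : ConvexOn ℝ univ g)
    (hfg : ∃ h : ℝ → ℝ, ConvexOn ℝ univ h ∧ ∀ x, h x ≤ f x - g x) :
    ConvexOn ℝ univ (fun x => f x - convexEnvelope (fun x => f x - g x) x) := by
  have hh := convexOn_convexEnvelope hfg
  have hle := convexEnvelope_le hfg
  set h := convexEnvelope (fun x => f x - g x) with hdef
  refine convexOn_of_chord fun x y z hxy hyz => ?_
  have hxz : 0 < z - x := by linarith
  -- `m * t + c` is the chord of `f - h` on `[x, z]`
  obtain ⟨m, c, hx, hz⟩ : ∃ m c : ℝ, m * x + c = f x - h x ∧ m * z + c = f z - h z := by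
    refine ⟨((f z - h z) - (f x - h x)) / (z - x),
      f x - h x - ((f z - h z) - (f x - h x)) / (z - x) * x, by ring, ?_⟩
    field_simp; ring
  have hgl : ∀ t ∈ Icc x z, g t ≤ m * t + c := by
    intro t ht
    have h1 := chord_of_convexOn hg (mem_univ x) (mem_univ z) ht.1 ht.2
    have h2 : g x ≤ m * x + c := by have := hle x; linarith
    have h3 : g z ≤ m * z + c := by have := hle z; linarith
    refine le_of_mul_le_mul_left (a := z - x) ?_ hxz
    have e1 := mul_le_mul_of_nonneg_left h2 (sub_nonneg.2 ht.2)
    have e2 := mul_le_mul_of_nonneg_left h3 (sub_nonneg.2 ht.1)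
    linear_combination h1 + e1 + e2
  have hpc : ConvexOn ℝ (Icc x z) (h ⊔ fun t => f t + ((-m) * t + (-c))) :=
    (hh.subset (subset_univ _) (convex_Icc x z)).sup
      ((hf.subset (subset_univ _) (convex_Icc x z)).add
        (convexOn_affine _ (convex_Icc x z) (-m) (-c)))
  have hglue := convexOn_ite_Icc (hxy.trans hyz).le hh hpc (fun t _ => le_sup_left)
    (by simp only [Pi.sup_apply]; exact sup_eq_left.2 (by linarith))
    (by simp only [Pi.sup_apply]; exact sup_eq_left.2 (by linarith))
  have key := le_convexEnvelope (f := fun x => f x - g x) hglue (fun t => by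
    by_cases ht : t ∈ Icc x z
    · simp only [if_pos ht, Pi.sup_apply]
      exact sup_le (hle t) (by have := hgl t ht; linarith)
    · simp only [if_neg ht]; exact hle t) y
  rw [if_pos (show y ∈ Icc x z from ⟨hxy.le, hyz.le⟩), ← hdef] at key
  have : f y + ((-m) * y + (-c)) ≤ h y := le_trans (le_max_right _ _) key
  rw [← hx, ← hz]
  have := mul_le_mul_of_nonneg_left this hxz.le
  linear_combination this

/-- If `f^c` is affine on `[a, b]` and `ψ` is convex, then `(f - ψ)^c` is affine on `[a, b]`:
there its chord, increased by `ψ`, is below `f^c`. -/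
theorem convexEnvelope_sub_affine_on {f ψ : ℝ → ℝ} (hψ : ConvexOn ℝ univ ψ)
    (hf' : ∃ h : ℝ → ℝ, ConvexOn ℝ univ h ∧ ∀ x, h x ≤ f x - ψ x) {a b m c : ℝ} (hab : a < b)
    (haff : ∀ x ∈ Icc a b, convexEnvelope f x = m * x + c) :
    ∃ m' c' : ℝ, ∀ x ∈ Icc a b, convexEnvelope (fun x => f x - ψ x) x = m' * x + c' := by
  have hf : ∃ h : ℝ → ℝ, ConvexOn ℝ univ h ∧ ∀ x, h x ≤ f x := by
    obtain ⟨h, hh, hle⟩ := hf'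
    exact ⟨_, hh.add hψ, fun x => by have := hle x; simp only [Pi.add_apply]; linarith⟩
  have hh := convexOn_convexEnvelope hf'
  have hle := convexEnvelope_le hf'
  have hadd := le_convexEnvelope (f := f) (hh.add hψ)
    (fun x => by have := hle x; simp only [Pi.add_apply]; linarith)
  set h := convexEnvelope (fun x => f x - ψ x) with hdef
  have hba : 0 < b - a := by linarith
  obtain ⟨m', c', ha, hb⟩ : ∃ m c : ℝ, m * a + c = h a ∧ m * b + c = h b := by
    refine ⟨(h b - h a) / (b - a), h a - (h b - h a) / (b - a) * a, by ring, ?_⟩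
    field_simp; ring
  have hchord : ∀ x ∈ Icc a b, h x ≤ m' * x + c' := by
    intro x hx
    have := chord_of_convexOn hh (mem_univ a) (mem_univ b) hx.1 hx.2
    rw [← ha, ← hb] at this
    refine le_of_mul_le_mul_left (a := b - a) ?_ hba
    linear_combination this
  have hglue := convexOn_ite_Icc hab.le hh (convexOn_affine _ (convex_Icc a b) m' c') hchord ha hb
  refine ⟨m', c', fun y hy => le_antisymm (hchord y hy) ?_⟩
  have key := le_convexEnvelope (f := fun x => f x - ψ x) hglue (fun t => by
    by_cases ht : t ∈ Icc a b
    · simp only [if_pos ht]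
      have h1 := convexEnvelope_le hf t
      rw [haff t ht] at h1
      have h2 := hadd a
      have h3 := hadd b
      simp only [Pi.add_apply] at h2 h3
      rw [haff a ⟨le_rfl, hab.le⟩, ← ha] at h2
      rw [haff b ⟨hab.le, le_rfl⟩, ← hb] at h3
      have h4 := chord_of_convexOn hψ (mem_univ a) (mem_univ b) ht.1 ht.2
      have e1 := mul_le_mul_of_nonneg_left h2 (sub_nonneg.2 ht.2)
      have e2 := mul_le_mul_of_nonneg_left h3 (sub_nonneg.2 ht.1)
      have : m' * t + c' + ψ t ≤ m * t + c := by
        refine le_of_mul_le_mul_left (a := b - a) ?_ hba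
        linear_combination h4 + e1 + e2
      linarith
    · simp only [if_neg ht]; exact hle t) y
  rwa [if_pos hy] at key

/-- At a point where `f^c` lies strictly below a continuous minorant of `f`, the subdifferential
of `f^c` has only one element. -/
theorem subdifferential_convexEnvelope_subsingleton {f F : ℝ → ℝ}
    (hf : ∃ h : ℝ → ℝ, ConvexOn ℝ univ h ∧ ∀ x, h x ≤ f x) {q s t : ℝ}
    (hF : ContinuousAt F q) (hFf : ∀ x, F x ≤ f x) (hq : convexEnvelope f q < F q)
    (hs : s ∈ subdifferential (convexEnvelope f) q)
    (ht : t ∈ subdifferential (convexEnvelope f) q) : t ≤ s := by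
  by_contra! hst
  have hh := convexOn_convexEnvelope hf
  have hle := convexEnvelope_le hf
  set h := convexEnvelope f with hdef
  obtain ⟨δ, hδ, hδF⟩ : ∃ δ > 0, ∀ x, |x - q| < δ → (F q + h q) / 2 < F x := by
    have := hF.eventually (lt_mem_nhds (show (F q + h q) / 2 < F q by linarith))
    obtain ⟨δ, hδ, H⟩ := Metric.eventually_nhds_iff.1 this
    exact ⟨δ, hδ, fun x hx => H (by rwa [Real.dist_eq])⟩
  -- A line through a point slightly above `(q, h q)`, whose slope lies between `s` and `t`,
  -- exceeds `h` only near `q`, and can be used to raise `h`.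
  set d := (t - s) / 2 with hd
  have hd0 : 0 < d := by simp only [hd]; linarith
  set m := (s + t) / 2 with hm
  obtain ⟨ε, hε, h1, h2⟩ : ∃ ε > 0, ε < d * δ ∧ ε * (1 + |m| / d) < (F q - h q) / 2 := by
    have hpos : 0 < 1 + |m| / d := by positivity
    refine ⟨min (d * δ / 2) ((F q - h q) / 2 / (1 + |m| / d) / 2), ?_, ?_, ?_⟩
    · have : 0 < F q - h q := by linarith
      positivity
    · refine (min_le_left _ _).trans_lt ?_
      have : 0 < d * δ := by positivity
      linarith
    · have h0 : 0 < F q - h q := by linarith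
      calc _ ≤ ((F q - h q) / 2 / (1 + |m| / d) / 2) * (1 + |m| / d) :=
            mul_le_mul_of_nonneg_right (min_le_right _ _) hpos.le
        _ = (F q - h q) / 2 / 2 := by field_simp
        _ < _ := by linarith
  have hmax : ConvexOn ℝ univ (h ⊔ fun x => m * x + (h q + ε - m * q)) :=
    hh.sup (convexOn_affine _ convex_univ _ _)
  have key := le_convexEnvelope (f := f) hmax (fun x => by
    refine sup_le (hle x) ?_
    by_cases hx : |x - q| < ε / d
    · have h3 : |x - q| < δ := hx.trans (by rw [div_lt_iff₀ hd0]; linarith)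
      refine le_trans ?_ ((hδF x h3).le.trans (hFf x))
      have h4 : m * (x - q) ≤ |m| * (ε / d) :=
        (le_abs_self _).trans (by rw [abs_mul]; gcongr)
      have h5 : ε * (1 + |m| / d) = ε + |m| * (ε / d) := by field_simp
      simp only
      linarith
    · refine le_trans ?_ (hle x)
      push Not at hx
      rw [div_le_iff₀ hd0] at hx
      rcases le_total q x with hqx | hqx
      · have := ht x
        rw [abs_of_nonneg (by linarith)] at hx
        have e : m + d = t := by simp only [hm, hd]; ring
        rw [← e] at this
        simp only; linarith
      · have := hs x
        rw [abs_of_nonpos (by linarith)] at hx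
        have e : m - d = s := by simp only [hm, hd]; ring
        rw [← e] at this
        simp only; linarith) q
  have : m * q + (h q + ε - m * q) ≤ h q := le_trans (le_max_right _ _) key
  linarith

theorem continuous_of_convexOn {f : ℝ → ℝ} (hf : ConvexOn ℝ univ f) : Continuous f := by
  rw [← continuousOn_univ]
  exact hf.continuousOn isOpen_univ

theorem subdifferential_bddAbove (f : ℝ → ℝ) (x : ℝ) : BddAbove (subdifferential f x) := by
  refine ⟨f (x + 1) - f x, fun s hs => ?_⟩
  have := hs (x + 1)
  linarith

/-- The subdifferential of a finite convex function has a largest element. -/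
theorem sSup_mem_subdifferential {f : ℝ → ℝ} (hf : ConvexOn ℝ univ f) (x : ℝ) :
    sSup (subdifferential f x) ∈ subdifferential f x := by
  have hne : (subdifferential f x).Nonempty := by
    have hx : x ∈ interior (univ : Set ℝ) := by simp
    refine ⟨derivWithin f (Ioi x) x, fun y => ?_⟩
    rcases lt_trichotomy x y with h | h | h
    · have := hf.rightDeriv_le_slope_of_mem_interior hx (mem_univ y) h
      rw [slope_def_field, le_div_iff₀ (by linarith)] at this
      linarith
    · subst h; simp
    · have h1 := hf.slope_le_leftDeriv_of_mem_interior (mem_univ y) hx h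
      have := h1.trans (hf.leftDeriv_le_rightDeriv_of_mem_interior hx)
      rw [slope_def_field, div_le_iff₀ (by linarith)] at this
      linarith
  have hcl : IsClosed (subdifferential f x) := by
    have : subdifferential f x = ⋂ y, {s : ℝ | f x + s * (y - x) ≤ f y} := by
      ext s; simp [subdifferential]
    rw [this]
    exact isClosed_iInter fun y => isClosed_le (by fun_prop) continuous_const
  exact hcl.csSup_mem hne (subdifferential_bddAbove f x)

/-- Subtracting a put payoff `δ (q - k)^+` removes a kink at `q`: if `f^c` is affine on `[a, q]`
with the slope of its largest supporting line at `q`, then so is `(f - δ (q - ·)^+)^c`. Either the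
new hull does not touch `f^c` at `q`, and has no kink there, or it touches it, and then the slopes
on the two sides of `q` would be in the wrong order. -/
theorem convexEnvelope_sub_put_eq {f : ℝ → ℝ} {a q δ : ℝ} (haq : a < q) (hδ : 0 < δ)
    (hf' : ∃ h : ℝ → ℝ, ConvexOn ℝ univ h ∧ ∀ x, h x ≤ f x - δ * max (q - x) 0)
    (haff : convexEnvelope f a =
      convexEnvelope f q + sSup (subdifferential (convexEnvelope f) q) * (a - q)) :
    convexEnvelope (fun x => f x - δ * max (q - x) 0) a =
      convexEnvelope (fun x => f x - δ * max (q - x) 0) q +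
        sSup (subdifferential (convexEnvelope fun x => f x - δ * max (q - x) 0) q) * (a - q) := by
  have hψ : ConvexOn ℝ univ (fun x => δ * max (q - x) 0) := by
    have h1 : ConvexOn ℝ univ ((fun x => (-1) * x + q) ⊔ fun x : ℝ => 0 * x + 0) :=
      (convexOn_affine univ convex_univ (-1) q).sup (convexOn_affine univ convex_univ 0 0)
    have h2 := h1.smul hδ.le
    refine h2.congr fun x _ => ?_
    simp only [smul_eq_mul, Pi.sup_apply]
    congr 2 <;> ring
  have hf : ∃ h : ℝ → ℝ, ConvexOn ℝ univ h ∧ ∀ x, h x ≤ f x := by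
    obtain ⟨h, hh, hle⟩ := hf'
    exact ⟨_, hh.add hψ, fun x => by have := hle x; simp only [Pi.add_apply]; linarith⟩
  have gc := convexOn_convexEnvelope hf
  have gle := convexEnvelope_le hf
  have hc := convexOn_convexEnvelope hf'
  have hle := convexEnvelope_le hf'
  have hadd := le_convexEnvelope (f := f) (hc.add hψ)
    (fun x => by have := hle x; simp only [Pi.add_apply]; linarith)
  have gφ := sSup_mem_subdifferential gc q
  have gmax : ∀ s ∈ subdifferential (convexEnvelope f) q,
      s ≤ sSup (subdifferential (convexEnvelope f) q) :=
    fun s hs => le_csSup (subdifferential_bddAbove _ _) hs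
  have hφ := sSup_mem_subdifferential hc q
  have hmax : ∀ s ∈ subdifferential (convexEnvelope fun x => f x - δ * max (q - x) 0) q,
      s ≤ sSup (subdifferential (convexEnvelope fun x => f x - δ * max (q - x) 0) q) :=
    fun s hs => le_csSup (subdifferential_bddAbove _ _) hs
  have gaff : ∀ x ∈ Icc a q, convexEnvelope f x =
      sSup (subdifferential (convexEnvelope f) q) * x +
        (convexEnvelope f q - sSup (subdifferential (convexEnvelope f) q) * q) := by
    refine eq_affine_of_contact gc haq.le (fun x => ?_) (by rw [haff]; ring) (by ring)
    have := gφ x; linarith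
  obtain ⟨s, c, hs⟩ := convexEnvelope_sub_affine_on hψ hf' haq gaff
  have touch := fun s t => subdifferential_convexEnvelope_subsingleton (q := q) (s := s) (t := t) hf'
    (F := fun x => convexEnvelope f x - δ * max (q - x) 0)
    ((continuous_of_convexOn gc).sub (continuous_of_convexOn hψ)).continuousAt
    (fun x => by have := gle x; linarith)
  set g := convexEnvelope f
  set h := convexEnvelope (fun x => f x - δ * max (q - x) 0)
  set φ := sSup (subdifferential g q)
  set χ := sSup (subdifferential h q)
  have hsq := hs q ⟨haq.le, le_rfl⟩
  have hsa := hs a ⟨le_rfl, haq.le⟩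
  have hsmem : s ∈ subdifferential h q := fun y => by
    have := affine_le_of_convexOn hc haq hs y
    linarith
  have hsχ : s ≤ χ := hmax s hsmem
  suffices χ ≤ s by
    have : χ = s := le_antisymm this hsχ
    rw [this, hsa, hsq]; ring
  have hgq : h q ≤ g q := by have := hadd q; simpa using this
  rcases eq_or_lt_of_le hgq with heq | hlt
  · have hga := hadd a
    simp only [Pi.add_apply] at hga
    rw [max_eq_left (by linarith), hsa, gaff a ⟨le_rfl, haq.le⟩] at hga
    have e1 : (φ + δ) * (q - a) ≤ s * (q - a) := by linarith
    have e2 : φ + δ ≤ s := le_of_mul_le_mul_right e1 (by linarith)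
    have e3 : χ ≤ φ := by
      refine gmax χ fun y => ?_
      rcases le_total q y with hy | hy
      · have h1 := hφ y
        have h2 := hadd y
        simp only [Pi.add_apply] at h2
        rw [max_eq_right (by linarith)] at h2
        linarith
      · have h1 := gφ y
        have : χ * (y - q) ≤ φ * (y - q) := mul_le_mul_of_nonpos_right (by linarith) (by linarith)
        linarith
    linarith
  · exact touch s χ (by simpa using hlt) hsmem hφ

/-! ### Put and call potentials -/

theorem FiniteFirstMoment.mono {η χ : Measure ℝ} (hχ : FiniteFirstMoment χ) (h : η ≤ χ) :
    FiniteFirstMoment η :=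
  ⟨have := hχ.1; isFiniteMeasure_of_le χ h, hχ.2.mono_measure h⟩

theorem FiniteFirstMoment.integrable_put {η : Measure ℝ} (hη : FiniteFirstMoment η) (k : ℝ) :
    Integrable (fun x => max (k - x) 0) η := by
  have := hη.1
  exact ((integrable_const k).sub hη.2).pos_part

theorem FiniteFirstMoment.integrable_call {η : Measure ℝ} (hη : FiniteFirstMoment η) (k : ℝ) :
    Integrable (fun x => max (x - k) 0) η := by
  have := hη.1
  exact (hη.2.sub (integrable_const k)).pos_part

theorem putPotential_nonneg (η : Measure ℝ) (k : ℝ) : 0 ≤ putPotential η k :=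
  integral_nonneg fun _ => le_max_right _ _

theorem callPotential_nonneg (η : Measure ℝ) (k : ℝ) : 0 ≤ callPotential η k :=
  integral_nonneg fun _ => le_max_right _ _

/-- Put-call parity. -/
theorem callPotential_eq {η : Measure ℝ} (hη : FiniteFirstMoment η) (k : ℝ) :
    callPotential η k = putPotential η k + ((∫ x, x ∂η) - k * η.real univ) := by
  have := hη.1
  have h1 : ∫ x, (x - k) ∂η = (∫ x, x ∂η) - k * η.real univ := by
    rw [integral_sub hη.2 (integrable_const k)]
    simp [mul_comm]
  have h2 : Integrable (fun x : ℝ => x - k) η := hη.2.sub (integrable_const k)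
  rw [← h1, callPotential, putPotential, ← integral_add (hη.integrable_put k) h2]
  refine integral_congr_ae (Eventually.of_forall fun x => ?_)
  simp only
  rcases le_total x k with h | h
  · rw [max_eq_right (by linarith), max_eq_left (by linarith)]; ring
  · rw [max_eq_left (by linarith), max_eq_right (by linarith)]; ring

theorem convexOn_putPotential {η : Measure ℝ} (hη : FiniteFirstMoment η) :
    ConvexOn ℝ univ (putPotential η) := by
  refine convexOn_of_chord fun x y z hxy hyz => ?_
  simp only [putPotential]
  rw [← integral_const_mul, ← integral_const_mul, ← integral_const_mul,
    ← integral_add ((hη.integrable_put _).const_mul _) ((hη.integrable_put _).const_mul _)]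
  refine integral_mono ((hη.integrable_put _).const_mul _)
    (((hη.integrable_put _).const_mul _).add ((hη.integrable_put _).const_mul _)) fun t => ?_
  have hc : ConvexOn ℝ univ ((fun x => 1 * x + -t) ⊔ fun x : ℝ => 0 * x + 0) :=
    (convexOn_affine univ convex_univ 1 (-t)).sup (convexOn_affine univ convex_univ 0 0)
  have := chord_of_convexOn hc (mem_univ x) (mem_univ z) hxy.le hyz.le
  simpa [sub_eq_add_neg] using this

theorem convexOn_callPotential {η : Measure ℝ} (hη : FiniteFirstMoment η) :
    ConvexOn ℝ univ (callPotential η) := by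
  refine ((convexOn_putPotential hη).add
    (convexOn_affine univ convex_univ (-η.real univ) (∫ x, x ∂η))).congr fun x _ => ?_
  rw [callPotential_eq hη]
  simp only [Pi.add_apply]; ring

theorem putPotential_add {α β : Measure ℝ} (hα : FiniteFirstMoment α) (hβ : FiniteFirstMoment β)
    (k : ℝ) : putPotential (α + β) k = putPotential α k + putPotential β k :=
  integral_add_measure (hα.integrable_put k) (hβ.integrable_put k)

theorem callPotential_add {α β : Measure ℝ} (hα : FiniteFirstMoment α) (hβ : FiniteFirstMoment β)
    (k : ℝ) : callPotential (α + β) k = callPotential α k + callPotential β k :=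
  integral_add_measure (hα.integrable_call k) (hβ.integrable_call k)

theorem FiniteFirstMoment.sub {η χ : Measure ℝ} (hχ : FiniteFirstMoment χ) :
    FiniteFirstMoment (χ - η) := hχ.mono Measure.sub_le

theorem putPotential_sub {η χ : Measure ℝ} (hχ : FiniteFirstMoment χ) (h : η ≤ χ) (k : ℝ) :
    putPotential (χ - η) k = putPotential χ k - putPotential η k := by
  have hη := hχ.mono h
  have := hη.1
  have e := putPotential_add (hχ.sub (η := η)) hη k
  rw [Measure.sub_add_cancel_of_le h] at e
  linarith

theorem callPotential_sub {η χ : Measure ℝ} (hχ : FiniteFirstMoment χ) (h : η ≤ χ) (k : ℝ) :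
    callPotential (χ - η) k = callPotential χ k - callPotential η k := by
  have hη := hχ.mono h
  have := hη.1
  have e := callPotential_add (hχ.sub (η := η)) hη k
  rw [Measure.sub_add_cancel_of_le h] at e
  linarith

theorem tendsto_callPotential_atTop {η : Measure ℝ} (hη : FiniteFirstMoment η) :
    Tendsto (callPotential η) atTop (nhds 0) := by
  have := tendsto_integral_filter_of_dominated_convergence (μ := η) (l := atTop)
    (F := fun k x => max (x - k) 0) (f := fun _ => 0) (fun x => |x|)
    (Eventually.of_forall fun k => (hη.integrable_call k).1)
    (by
      filter_upwards [eventually_ge_atTop 0] with k hk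
      refine Eventually.of_forall fun x => ?_
      rw [Real.norm_of_nonneg (le_max_right _ _)]
      exact max_le (by have := le_abs_self x; linarith) (abs_nonneg x))
    hη.2.abs
    (Eventually.of_forall fun x => by
      refine tendsto_const_nhds.congr' ?_
      filter_upwards [eventually_ge_atTop x] with k hk
      rw [max_eq_right (by linarith)])
  rw [integral_zero] at this
  exact this

theorem tendsto_putPotential_atBot {η : Measure ℝ} (hη : FiniteFirstMoment η) :
    Tendsto (putPotential η) atBot (nhds 0) := by
  have := tendsto_integral_filter_of_dominated_convergence (μ := η) (l := atBot)
    (F := fun k x => max (k - x) 0) (f := fun _ => 0) (fun x => |x|)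
    (Eventually.of_forall fun k => (hη.integrable_put k).1)
    (by
      filter_upwards [eventually_le_atBot 0] with k hk
      refine Eventually.of_forall fun x => ?_
      rw [Real.norm_of_nonneg (le_max_right _ _)]
      exact max_le (by have := neg_abs_le x; linarith) (abs_nonneg x))
    hη.2.abs
    (Eventually.of_forall fun x => by
      refine tendsto_const_nhds.congr' ?_
      filter_upwards [eventually_le_atBot x] with k hk
      rw [max_eq_right (by linarith)])
  rw [integral_zero] at this
  exact this

theorem callPotential_eq_zero_iff {η : Measure ℝ} (hη : FiniteFirstMoment η) (k : ℝ) :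
    callPotential η k = 0 ↔ η (Ioi k) = 0 := by
  refine (integral_eq_zero_iff_of_nonneg (fun _ => le_max_right _ _)
    (hη.integrable_call k)).trans ?_
  have : {x : ℝ | ¬ max (x - k) 0 = 0} = Ioi k := by
    ext x; simp
  rw [← this]
  rfl

theorem lintegral_put {η : Measure ℝ} (hη : FiniteFirstMoment η) (k : ℝ) :
    ∫⁻ x, ENNReal.ofReal (k - x) ∂η = ENNReal.ofReal (putPotential η k) := by
  rw [putPotential, ofReal_integral_eq_lintegral_ofReal (hη.integrable_put k)
    (Eventually.of_forall fun _ => le_max_right _ _)]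
  refine lintegral_congr fun x => ?_
  rw [ENNReal.ofReal_max]; simp

/-! ### The second derivative of a convex function -/

/-- The right derivative of a convex function, made right-continuous. -/
theorem exists_stieltjesFunction_of_convexOn {f : ℝ → ℝ} (hf : ConvexOn ℝ univ f) :
    ∃ G : StieltjesFunction ℝ, ∀ a b : ℝ, ∫ x in a..b, G x = f b - f a := by
  have hm : Monotone fun x => derivWithin f (Ioi x) x := by
    have := hf.monotoneOn_rightDeriv
    rwa [interior_univ, monotoneOn_univ] at this
  refine ⟨hm.stieltjesFunction, fun a b => ?_⟩
  have hae : ∀ᵐ x : ℝ, hm.stieltjesFunction x = derivWithin f (Ioi x) x := by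
    filter_upwards [hm.countable_not_continuousAt.ae_notMem volume] with x hx
    rw [hm.stieltjesFunction_eq]
    simp only [not_not] at hx
    exact hm.continuousWithinAt_Ioi_iff_rightLim_eq.1 hx.continuousWithinAt
  rw [intervalIntegral.integral_congr_ae (g := fun x => derivWithin f (Ioi x) x)
    (hae.mono fun x hx _ => hx)]
  refine intervalIntegral.integral_eq_sub_of_hasDeriv_right
    (continuous_of_convexOn hf).continuousOn (fun x _ => ?_) hm.intervalIntegrable
  exact hf.hasDerivWithinAt_rightDeriv_of_mem_interior (by simp)

/-- Layer-cake formula for a call payoff. -/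
theorem lintegral_ofReal_sub_eq (γ : Measure ℝ) [SFinite γ] (x : ℝ) :
    ∫⁻ t, ENNReal.ofReal (t - x) ∂γ = ∫⁻ s in Ioi x, γ (Ioi s) := by
  have h1 : ∀ t, ENNReal.ofReal (t - x) =
      ∫⁻ s in Ioi x, (Iio t).indicator (fun _ => (1 : ENNReal)) s := by
    intro t
    rw [lintegral_indicator measurableSet_Iio]
    simp [Measure.restrict_restrict, Iio_inter_Ioi]
  simp_rw [h1]
  rw [lintegral_lintegral_swap]
  · refine lintegral_congr fun s => ?_
    have : ∀ t, (Iio t).indicator (fun _ => (1 : ENNReal)) s =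
        (Ioi s).indicator (fun _ => (1 : ENNReal)) t := by
      intro t; simp [indicator]
    simp_rw [this]
    rw [lintegral_indicator measurableSet_Ioi]; simp
  · have : (Function.uncurry fun (t s : ℝ) => (Iio t).indicator (fun _ => (1 : ENNReal)) s) =
        {p : ℝ × ℝ | p.2 < p.1}.indicator fun _ => 1 := by
      ext p; simp [Function.uncurry, indicator]
    rw [this]
    exact (measurable_const.indicator
      (measurableSet_lt measurable_snd measurable_fst)).aemeasurable

/-- Layer-cake formula for a put payoff. -/
theorem lintegral_ofReal_const_sub_eq (γ : Measure ℝ) [SFinite γ] (k : ℝ) :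
    ∫⁻ t, ENNReal.ofReal (k - t) ∂γ = ∫⁻ s in Iic k, γ (Iic s) := by
  have h1 : ∀ t, ENNReal.ofReal (k - t) =
      ∫⁻ s in Iic k, (Ici t).indicator (fun _ => (1 : ENNReal)) s := by
    intro t
    rw [lintegral_indicator measurableSet_Ici]
    simp [Measure.restrict_restrict, Ici_inter_Iic]
  simp_rw [h1]
  rw [lintegral_lintegral_swap]
  · refine lintegral_congr fun s => ?_
    have : ∀ t, (Ici t).indicator (fun _ => (1 : ENNReal)) s =
        (Iic s).indicator (fun _ => (1 : ENNReal)) t := by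
      intro t; simp [indicator]
    simp_rw [this]
    rw [lintegral_indicator measurableSet_Iic]; simp
  · have : (Function.uncurry fun (t s : ℝ) => (Ici t).indicator (fun _ => (1 : ENNReal)) s) =
        {p : ℝ × ℝ | p.1 ≤ p.2}.indicator fun _ => 1 := by
      ext p; simp [Function.uncurry, indicator]
    rw [this]
    exact (measurable_const.indicator
      (measurableSet_le measurable_fst measurable_snd)).aemeasurable

theorem stieltjesFunction_mem_subdifferential {f : ℝ → ℝ} {G : StieltjesFunction ℝ}
    (hG : ∀ a b : ℝ, ∫ x in a..b, G x = f b - f a) (b : ℝ) : G b ∈ subdifferential f b := by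
  have hi : ∀ u v : ℝ, IntervalIntegrable G volume u v := fun u v => G.mono.intervalIntegrable
  intro x
  rcases le_total b x with h | h
  · have := intervalIntegral.integral_mono_on h intervalIntegrable_const (hi b x)
      (fun t ht => G.mono ht.1)
    rw [hG, intervalIntegral.integral_const, smul_eq_mul] at this
    linarith
  · have := intervalIntegral.integral_mono_on h (hi x b) intervalIntegrable_const
      (fun t ht => G.mono ht.2)
    rw [hG, intervalIntegral.integral_const, smul_eq_mul] at this
    linarith

/-- On `(-∞, b]`, a convex function is its tangent at `b` plus a mixture of put payoffs. -/
theorem lintegral_put_stieltjes {f : ℝ → ℝ} {G : StieltjesFunction ℝ}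
    (hG : ∀ a b : ℝ, ∫ x in a..b, G x = f b - f a) (b x : ℝ) :
    ∫⁻ t in Iic b, ENNReal.ofReal (t - x) ∂G.measure =
      ENNReal.ofReal ((Iic b).indicator (fun x => f x - (f b + G b * (x - b))) x) := by
  have hi : ∀ u v : ℝ, IntervalIntegrable G volume u v := fun u v => G.mono.intervalIntegrable
  rw [lintegral_ofReal_sub_eq]
  have h1 : ∀ s, (G.measure.restrict (Iic b)) (Ioi s) = ENNReal.ofReal (G b - G s) := by
    intro s
    rw [Measure.restrict_apply measurableSet_Ioi, Ioi_inter_Iic, G.measure_Ioc]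
  simp_rw [h1]
  by_cases hx : x ≤ b
  · rw [indicator_of_mem (by exact hx)]
    have h2 : ∫⁻ s in Ioi x, ENNReal.ofReal (G b - G s) =
        ∫⁻ s in Ioc x b, ENNReal.ofReal (G b - G s) := by
      have h3 : ∫⁻ s in Ioi b, ENNReal.ofReal (G b - G s) = 0 := by
        rw [setLIntegral_congr_fun measurableSet_Ioi (g := fun _ => 0), lintegral_zero]
        intro s hs
        exact ENNReal.ofReal_of_nonpos (sub_nonpos.2 (G.mono (le_of_lt hs)))
      rw [← Ioc_union_Ioi_eq_Ioi hx, lintegral_union measurableSet_Ioi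
        (Ioc_disjoint_Ioi le_rfl), h3, add_zero]
    have h3 : ∫ s in x..b, (G b - G s) = f x - (f b + G b * (x - b)) := by
      rw [intervalIntegral.integral_sub intervalIntegrable_const (hi x b), hG,
        intervalIntegral.integral_const, smul_eq_mul]
      ring
    rw [h2, ← h3, intervalIntegral.integral_of_le hx, ofReal_integral_eq_lintegral_ofReal]
    · exact (intervalIntegrable_const.sub (hi x b)).1
    · filter_upwards [ae_restrict_mem measurableSet_Ioc] with s hs
      exact sub_nonneg.2 (G.mono hs.2)
  · rw [indicator_of_notMem (by exact hx), ENNReal.ofReal_zero]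
    push Not at hx
    rw [setLIntegral_congr_fun measurableSet_Ioi (g := fun _ => 0), lintegral_zero]
    intro s hs
    exact ENNReal.ofReal_of_nonpos (sub_nonpos.2 (G.mono (hx.le.trans (le_of_lt hs))))

/-- A pointwise inequality of put potentials of measures with the same mass gives the
convex-decreasing order. A convex non-increasing function, continued beyond `b` by its tangent
there, is a non-increasing affine function plus a mixture of put payoffs; then `b → ∞`. -/
theorem convexDecreasingLE_of_putPotential_le {η χ : Measure ℝ} (hη : FiniteFirstMoment η)
    (hχ : FiniteFirstMoment χ) (hm : η.real univ = χ.real univ)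
    (hP : ∀ k, putPotential η k ≤ putPotential χ k) : ConvexDecreasingLE η χ := by
  intro f hf hanti hfη hfχ
  have := hη.1
  have := hχ.1
  obtain ⟨G, hG⟩ := exists_stieltjesFunction_of_convexOn hf
  have htan := stieltjesFunction_mem_subdifferential hG
  have hG0 : ∀ b, G b ≤ 0 := fun b => by
    have h1 := htan b (b + 1)
    have h2 := hanti (show b ≤ b + 1 by linarith)
    linarith
  have hmean : ∫ x, x ∂χ ≤ ∫ x, x ∂η := by
    have h1 : ∀ k, (∫ x, x ∂χ) - ∫ x, x ∂η ≤ callPotential χ k := fun k => by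
      have h2 := callPotential_eq hη k
      have h3 := callPotential_eq hχ k
      have h4 := callPotential_nonneg η k
      have := hP k
      rw [hm] at h2
      linarith
    have := ge_of_tendsto' (tendsto_callPotential_atTop hχ) h1
    linarith
  set p : ℝ → ℝ → ℝ := fun b => (Iic b).indicator fun x => f x - (f b + G b * (x - b)) with hp
  have hp0 : ∀ b x, 0 ≤ p b x := fun b x =>
    indicator_nonneg (fun y _ => by have := htan b y; linarith) x
  have hint : ∀ θ : Measure ℝ, FiniteFirstMoment θ → ∀ b, Integrable
      (fun x => f b + G b * (x - b)) θ := fun θ hθ b => by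
    have := hθ.1
    exact (integrable_const _).add ((hθ.2.sub (integrable_const b)).const_mul _)
  have hpint : ∀ θ : Measure ℝ, FiniteFirstMoment θ → Integrable f θ → ∀ b, Integrable (p b) θ :=
    fun θ hθ hfθ b => (hfθ.sub (hint θ hθ b)).indicator measurableSet_Iic
  have hlin : ∀ θ : Measure ℝ, FiniteFirstMoment θ → ∀ b, ∫⁻ x, ENNReal.ofReal (p b x) ∂θ =
      ∫⁻ t in Iic b, ENNReal.ofReal (putPotential θ t) ∂G.measure := fun θ hθ b => by
    have := hθ.1
    simp_rw [hp, ← lintegral_put_stieltjes hG, ← lintegral_put hθ]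
    exact lintegral_lintegral_swap (by fun_prop)
  have hple : ∀ b, ∫ x, p b x ∂η ≤ ∫ x, p b x ∂χ := fun b => by
    rw [← ENNReal.ofReal_le_ofReal_iff (integral_nonneg (hp0 b)),
      ofReal_integral_eq_lintegral_ofReal (hpint η hη hfη b) (Eventually.of_forall (hp0 b)),
      ofReal_integral_eq_lintegral_ofReal (hpint χ hχ hfχ b) (Eventually.of_forall (hp0 b)),
      hlin η hη, hlin χ hχ]
    exact lintegral_mono fun t => ENNReal.ofReal_le_ofReal (hP t)
  have hFle : ∀ b, ∫ x, (p b x + (f b + G b * (x - b))) ∂η ≤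
      ∫ x, (p b x + (f b + G b * (x - b))) ∂χ := fun b => by
    have e : ∀ θ : Measure ℝ, FiniteFirstMoment θ → ∫ x, (f b + G b * (x - b)) ∂θ =
        (f b - G b * b) * θ.real univ + G b * ∫ x, x ∂θ := fun θ hθ => by
      have := hθ.1
      have e1 : ∀ x, f b + G b * (x - b) = (f b - G b * b) + G b * x := fun x => by ring
      simp_rw [e1]
      rw [integral_add (integrable_const _) (hθ.2.const_mul _), integral_const_mul]
      simp [mul_comm]
    rw [integral_add (hpint η hη hfη b) (hint η hη b), integral_add (hpint χ hχ hfχ b) (hint χ hχ b),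
      e η hη, e χ hχ, hm]
    have := hple b
    have := mul_le_mul_of_nonpos_left hmean (hG0 b)
    linarith
  have hlim : ∀ θ : Measure ℝ, FiniteFirstMoment θ → Integrable f θ →
      Tendsto (fun b => ∫ x, (p b x + (f b + G b * (x - b))) ∂θ) atTop (nhds (∫ x, f x ∂θ)) := by
    intro θ hθ hfθ
    have := hθ.1
    refine tendsto_integral_filter_of_dominated_convergence
      (fun x => |f x| + (|f 0| + |G 0| * |x|)) ?_ ?_ ?_ ?_
    · exact Eventually.of_forall fun b => ((hpint θ hθ hfθ b).add (hint θ hθ b)).1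
    · filter_upwards [eventually_ge_atTop 0] with b hb
      refine Eventually.of_forall fun x => ?_
      have h0 : 0 ≤ |f 0| + |G 0| * |x| := by positivity
      rw [Real.norm_eq_abs]
      by_cases hx : x ≤ b
      · have : p b x = f x - (f b + G b * (x - b)) := indicator_of_mem (by exact hx) _
        rw [this, sub_add_cancel]; linarith
      · have : p b x = 0 := indicator_of_notMem (by exact hx) _
        rw [this, zero_add]
        push Not at hx
        have h1 := htan b x
        have h2 := htan 0 b
        have h3 := mul_le_mul_of_nonneg_right (G.mono hb) (sub_nonneg.2 hx.le)
        have h4 := le_abs_self (f x)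
        have h5 := neg_abs_le (f 0)
        have h6 : -(|G 0| * |x|) ≤ G 0 * x := by rw [← abs_mul]; exact neg_abs_le _
        refine abs_le.2 ⟨?_, ?_⟩
        · have := abs_nonneg (f x); linarith
        · linarith
    · exact hfθ.abs.add ((integrable_const _).add (hθ.2.abs.const_mul _))
    · refine Eventually.of_forall fun x => tendsto_const_nhds.congr' ?_
      filter_upwards [eventually_ge_atTop x] with b hb
      have : p b x = f x - (f b + G b * (x - b)) := indicator_of_mem (by exact hb) _
      rw [this, sub_add_cancel]
  exact le_of_tendsto_of_tendsto' (hlim η hη hfη) (hlim χ hχ hfχ) hFle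

/-- A convex function which tends to `0` at `-∞` and grows at most linearly at `∞` is the put
potential of a finite measure, the Lebesgue-Stieltjes measure of its right derivative. The measure
need not have a first moment, but it integrates the put payoffs. -/
theorem exists_measure_putPotential_eq {w : ℝ → ℝ} (hw : ConvexOn ℝ univ w)
    (h0 : Tendsto w atBot (nhds 0)) {m c : ℝ} (hlin : ∀ k, 0 ≤ k → w k ≤ m * k + c) :
    ∃ ρ : Measure ℝ, IsFiniteMeasure ρ ∧ (∀ k, Integrable (fun x => max (k - x) 0) ρ) ∧
      ∀ k, putPotential ρ k = w k := by
  obtain ⟨G, hG⟩ := exists_stieltjesFunction_of_convexOn hw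
  have htan := stieltjesFunction_mem_subdifferential hG
  have hi : ∀ u v : ℝ, IntervalIntegrable G volume u v := fun u v => G.mono.intervalIntegrable
  have hGbot : Tendsto G atBot (nhds 0) := by
    have ha : Tendsto (fun b => w (b + 1) - w b) atBot (nhds 0) := by
      simpa using (h0.comp (tendsto_atBot_add_const_right _ 1 tendsto_id)).sub h0
    have hb : Tendsto (fun b => w b - w (b + -1)) atBot (nhds 0) := by
      simpa using h0.sub (h0.comp (tendsto_atBot_add_const_right _ (-1) tendsto_id))
    refine tendsto_of_tendsto_of_tendsto_of_le_of_le hb ha (fun b => ?_) (fun b => ?_)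
    · have := htan b (b + -1); simp only; linarith
    · have := htan b (b + 1); simp only; linarith
  have hGnn : ∀ b, 0 ≤ G b := fun b => G.mono.le_of_tendsto hGbot b
  have hGle : ∀ b, G b ≤ m := by
    intro b
    by_contra! hlt
    set K := max 0 ((c + G b * b - w b) / (G b - m) + 1)
    have h1 := htan b K
    have h2 := hlin K (le_max_left _ _)
    have h3 : (c + G b * b - w b) / (G b - m) < K :=
      lt_of_lt_of_le (by linarith) (le_max_right _ _)
    rw [div_lt_iff₀ (by linarith)] at h3
    linarith
  have hfin : IsFiniteMeasure G.measure :=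
    G.isFiniteMeasure_of_forall_abs_le (C := m) fun x => by
      rw [abs_of_nonneg (hGnn x)]; exact hGle x
  have hFTC : ∀ k, Tendsto (fun a => ∫ x in a..k, G x) atBot (nhds (w k)) := fun k => by
    simp_rw [hG]
    simpa using tendsto_const_nhds.sub h0
  have hw0 : ∀ k, 0 ≤ w k := fun k => by
    refine ge_of_tendsto (hFTC k) ?_
    filter_upwards [eventually_le_atBot k] with a ha
    exact intervalIntegral.integral_nonneg ha fun t _ => hGnn t
  have hput : ∀ k, ∫⁻ x, ENNReal.ofReal (max (k - x) 0) ∂G.measure = ENNReal.ofReal (w k) := by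
    intro k
    have hint : IntegrableOn G (Iic k) := by
      refine integrableOn_Iic_of_intervalIntegral_norm_tendsto (w k) k
        (fun a => (hi a k).1) tendsto_id ?_
      refine (hFTC k).congr fun a => intervalIntegral.integral_congr fun x _ => ?_
      exact (Real.norm_of_nonneg (hGnn x)).symm
    have hval := tendsto_nhds_unique (intervalIntegral_tendsto_integral_Iic k hint tendsto_id)
      (hFTC k)
    rw [← hval, ofReal_integral_eq_lintegral_ofReal hint (Eventually.of_forall hGnn)]
    have h1 : ∀ x, ENNReal.ofReal (max (k - x) 0) = ENNReal.ofReal (k - x) := fun x => by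
      rw [ENNReal.ofReal_max]; simp
    simp_rw [h1]
    rw [lintegral_ofReal_const_sub_eq]
    refine lintegral_congr fun s => ?_
    rw [G.measure_Iic hGbot, sub_zero]
  have hnn : ∀ k : ℝ, 0 ≤ᵐ[G.measure] fun x => max (k - x) 0 := fun k =>
    Eventually.of_forall fun _ => le_max_right _ _
  have hpi : ∀ k, Integrable (fun x => max (k - x) 0) G.measure := fun k => by
    refine (lintegral_ofReal_ne_top_iff_integrable (by fun_prop) (hnn k)).1 ?_
    rw [hput k]
    exact ENNReal.ofReal_ne_top
  refine ⟨G.measure, hfin, hpi, fun k => ?_⟩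
  rw [putPotential, integral_eq_lintegral_of_nonneg_ae (hnn k) (hpi k).1]
  rw [hput k, ENNReal.toReal_ofReal (hw0 k)]

/-- A finite measure is determined by its put potential: `1_{(-∞, a]}` is the limit of put
spreads. -/
theorem measure_eq_of_putPotential_eq {α β : Measure ℝ} [IsFiniteMeasure α] [IsFiniteMeasure β]
    (hα : ∀ k, Integrable (fun x => max (k - x) 0) α)
    (hβ : ∀ k, Integrable (fun x => max (k - x) 0) β)
    (h : ∀ k, putPotential α k = putPotential β k) : α = β := by
  have key : ∀ θ : Measure ℝ, IsFiniteMeasure θ →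
      (∀ k, Integrable (fun x => max (k - x) 0) θ) → ∀ a,
      Tendsto (fun n : ℕ => ((n : ℝ) + 1) *
        (putPotential θ (a + 1 / ((n : ℝ) + 1)) - putPotential θ a)) atTop
        (nhds (θ.real (Iic a))) := by
    intro θ _ hθ a
    have e1 : ∀ n : ℕ, ((n : ℝ) + 1) *
        (putPotential θ (a + 1 / ((n : ℝ) + 1)) - putPotential θ a) =
        ∫ x, ((n : ℝ) + 1) * (max (a + 1 / ((n : ℝ) + 1) - x) 0 - max (a - x) 0) ∂θ := fun n => by
      rw [integral_const_mul, integral_sub (hθ _) (hθ _)]; rfl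
    have e2 : θ.real (Iic a) = ∫ x, (Iic a).indicator (fun _ => (1 : ℝ)) x ∂θ := by
      rw [integral_indicator measurableSet_Iic]; simp
    simp_rw [e1]
    rw [e2]
    refine tendsto_integral_of_dominated_convergence (fun _ => 1)
      (fun n => (((hθ _).sub (hθ _)).const_mul _).1) (integrable_const 1) ?_ ?_
    · intro n
      refine Eventually.of_forall fun x => ?_
      have hn : 0 < (n : ℝ) + 1 := by positivity
      have hd : 0 ≤ 1 / ((n : ℝ) + 1) := by positivity
      have h1 : 0 ≤ max (a + 1 / ((n : ℝ) + 1) - x) 0 - max (a - x) 0 :=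
        sub_nonneg.2 (max_le_max (by linarith) le_rfl)
      have h2 : max (a + 1 / ((n : ℝ) + 1) - x) 0 - max (a - x) 0 ≤ 1 / ((n : ℝ) + 1) := by
        have := le_max_left (a - x) 0
        have := le_max_right (a - x) 0
        rw [sub_le_iff_le_add]
        exact max_le (by linarith) (by linarith)
      rw [Real.norm_of_nonneg (mul_nonneg hn.le h1)]
      calc _ ≤ ((n : ℝ) + 1) * (1 / ((n : ℝ) + 1)) := mul_le_mul_of_nonneg_left h2 hn.le
        _ = 1 := by field_simp
    · refine Eventually.of_forall fun x => ?_
      by_cases hx : x ≤ a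
      · rw [indicator_of_mem (by exact hx)]
        refine tendsto_const_nhds.congr fun n => ?_
        have hn : 0 < (n : ℝ) + 1 := by positivity
        have hd : 0 ≤ 1 / ((n : ℝ) + 1) := by positivity
        rw [max_eq_left (by linarith), max_eq_left (by linarith)]
        field_simp; ring
      · rw [indicator_of_notMem (by exact hx)]
        push Not at hx
        refine tendsto_const_nhds.congr' ?_
        filter_upwards [(tendsto_one_div_add_atTop_nhds_zero_nat (𝕜 := ℝ)).eventually
          (gt_mem_nhds (sub_pos.2 hx))] with n hn
        rw [max_eq_right (by linarith), max_eq_right (by linarith)]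
        ring
  refine Measure.ext_of_Iic α β fun a => ?_
  have h1 := key α inferInstance hα a
  simp_rw [h] at h1
  have := tendsto_nhds_unique h1 (key β inferInstance hβ a)
  exact (measureReal_eq_measureReal_iff).1 this

/-! ### Existence and potential of the shadow -/

theorem ConvexDecreasingLE.putPotential_le {η χ : Measure ℝ} (h : ConvexDecreasingLE η χ)
    (hη : FiniteFirstMoment η) (hχ : FiniteFirstMoment χ) (k : ℝ) :
    putPotential η k ≤ putPotential χ k := by
  refine h _ ?_ ?_ (hη.integrable_put k) (hχ.integrable_put k)
  · refine (((convexOn_affine univ convex_univ (-1) k).sup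
      (convexOn_affine univ convex_univ 0 0))).congr fun x _ => ?_
    simp only [Pi.sup_apply]
    congr 1 <;> ring
  · intro x y hxy
    exact max_le_max (by linarith) le_rfl

theorem ConvexDecreasingLE.measureReal_univ_eq {η χ : Measure ℝ} (h : ConvexDecreasingLE η χ)
    (hη : FiniteFirstMoment η) (hχ : FiniteFirstMoment χ) : η.real univ = χ.real univ := by
  have := hη.1
  have := hχ.1
  have key : ∀ c : ℝ, c * η.real univ ≤ c * χ.real univ := fun c => by
    have := h (fun _ => c) (convexOn_const c convex_univ) antitone_const (integrable_const c)
      (integrable_const c)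
    simpa [mul_comm] using this
  have h1 := key 1
  have h2 := key (-1)
  linarith

theorem putPotential_le_linear {η : Measure ℝ} (hη : FiniteFirstMoment η) {k : ℝ} (hk : 0 ≤ k) :
    putPotential η k ≤ η.real univ * k + putPotential η 0 := by
  have := hη.1
  have e : η.real univ * k + putPotential η 0 = ∫ x, (k + max (0 - x) 0) ∂η := by
    rw [integral_add (integrable_const k) (hη.integrable_put 0)]
    simp [putPotential]
  rw [e]
  refine integral_mono (hη.integrable_put k) ((integrable_const k).add (hη.integrable_put 0))
    fun x => ?_
  have h1 := le_max_left (0 - x) 0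
  have h2 := le_max_right (0 - x) 0
  exact max_le (by linarith) (by linarith)

theorem le_of_forall_mul_le_mul_add {a b c : ℝ} (h : ∀ k, 0 ≤ k → a * k ≤ b * k + c) : a ≤ b := by
  by_contra! hlt
  have h1 := h (max 0 (c / (a - b) + 1)) (le_max_left _ _)
  have h2 : c / (a - b) < max 0 (c / (a - b) + 1) :=
    lt_of_lt_of_le (by linarith) (le_max_right _ _)
  rw [div_lt_iff₀ (by linarith)] at h2
  linarith

/-- The shadow of `η` in `ν` exists as soon as `η` has at most the mass of `ν` and its put potential
is below that of `ν`: the hull `(P_ν - P_η)^c` and `P_ν - (P_ν - P_η)^c` are both convex, hence put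
potentials of two measures with sum `ν`; the second measure is the shadow. -/
theorem exists_isShadow {η ν : Measure ℝ} (hη : FiniteFirstMoment η) (hν : FiniteFirstMoment ν)
    (hm : η.real univ ≤ ν.real univ) (hP : ∀ k, putPotential η k ≤ putPotential ν k) :
    ∃ σ, IsShadow η ν σ ∧ ∀ k, putPotential (ν - σ) k =
      convexEnvelope (fun k => putPotential ν k - putPotential η k) k := by
  have := hη.1
  have := hν.1
  have hex : ∃ h : ℝ → ℝ, ConvexOn ℝ univ h ∧
      ∀ x, h x ≤ putPotential ν x - putPotential η x :=
    ⟨fun _ => 0, convexOn_const 0 convex_univ, fun x => sub_nonneg.2 (hP x)⟩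
  have hc := convexOn_convexEnvelope hex
  have hle := convexEnvelope_le hex
  have hw := convexOn_sub_convexEnvelope_sub (convexOn_putPotential hν) (convexOn_putPotential hη)
    hex
  have hmin := fun {g : ℝ → ℝ} (hg : ConvexOn ℝ univ g) =>
    le_convexEnvelope (f := fun k => putPotential ν k - putPotential η k) hg
  set h := convexEnvelope (fun k => putPotential ν k - putPotential η k) with hdef
  have h0 : ∀ k, 0 ≤ h k :=
    hmin (convexOn_const 0 convex_univ) fun x => sub_nonneg.2 (hP x)
  have hlow : ∀ k, (ν.real univ - η.real univ) * k + -(|∫ x, x ∂ν| + putPotential η 0) ≤ h k := by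
    refine hmin (convexOn_affine univ convex_univ _ _) fun k => ?_
    have h1 := putPotential_nonneg η 0
    have h2 := abs_nonneg (∫ x, x ∂ν)
    rcases le_total 0 k with hk | hk
    · have h3 := putPotential_le_linear hη hk
      have h4 := callPotential_eq hν k
      have h5 := callPotential_nonneg ν k
      have h6 := le_abs_self (∫ x, x ∂ν)
      linarith
    · have h3 := mul_nonpos_of_nonneg_of_nonpos (sub_nonneg.2 hm) hk
      have h4 := hP k
      linarith
  have hle' : ∀ k, h k ≤ putPotential ν k := fun k => by
    have h1 := hle k
    have h2 := putPotential_nonneg η k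
    linarith
  have hbot : Tendsto h atBot (nhds 0) :=
    tendsto_of_tendsto_of_tendsto_of_le_of_le tendsto_const_nhds (tendsto_putPotential_atBot hν)
      h0 hle'
  have wbot : Tendsto (fun k => putPotential ν k - h k) atBot (nhds 0) := by
    simpa using (tendsto_putPotential_atBot hν).sub hbot
  obtain ⟨ρ, hρf, hρi, hρ⟩ := exists_measure_putPotential_eq hc hbot
    (fun k hk => (hle' k).trans (putPotential_le_linear hν hk))
  obtain ⟨σ, hσf, hσi, hσ⟩ := exists_measure_putPotential_eq hw wbot
    (fun k hk => (sub_le_self _ (h0 k)).trans (putPotential_le_linear hν hk))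
  have hsum : ρ + σ = ν := by
    refine measure_eq_of_putPotential_eq (fun k => (hρi k).add_measure (hσi k))
      hν.integrable_put fun k => ?_
    have e : putPotential (ρ + σ) k = putPotential ρ k + putPotential σ k :=
      integral_add_measure (hρi k) (hσi k)
    rw [e, hρ, hσ]; ring
  have hρν : ρ ≤ ν := hsum ▸ Measure.le_add_right le_rfl
  have hσν : σ ≤ ν := hsum ▸ Measure.le_add_left le_rfl
  have hρm := hν.mono hρν
  have hσm := hν.mono hσν
  have hmass : ρ.real univ + σ.real univ = ν.real univ := by
    rw [← hsum, measureReal_add_apply]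
  have hmρ : ν.real univ - η.real univ ≤ ρ.real univ := by
    refine le_of_forall_mul_le_mul_add
      (c := putPotential ρ 0 + (|∫ x, x ∂ν| + putPotential η 0)) fun k hk => ?_
    have h1 := putPotential_le_linear hρm hk
    have h2 := hlow k
    have h3 := hρ k
    linarith
  have hησ : ∀ k, putPotential η k ≤ putPotential σ k := fun k => by
    have h1 := hle k
    have h2 := hσ k
    linarith
  have hmσ : η.real univ ≤ σ.real univ := by
    refine le_of_forall_mul_le_mul_add (c := putPotential σ 0 + ∫ x, x ∂η) fun k hk => ?_
    have h1 := putPotential_le_linear hσm hk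
    have h2 := hησ k
    have h3 := callPotential_eq hη k
    have h4 := callPotential_nonneg η k
    linarith
  have hmeq : η.real univ = σ.real univ := by linarith
  refine ⟨σ, ⟨⟨hσm, convexDecreasingLE_of_putPotential_le hη hσm hmeq hησ, hσν⟩, ?_⟩, fun k => ?_⟩
  · rintro θ ⟨hθ, hηθ, hθν⟩
    refine convexDecreasingLE_of_putPotential_le hσm hθ
      (hmeq ▸ hηθ.measureReal_univ_eq hη hθ) fun k => ?_
    have h1 := hmin (convexOn_putPotential (hν.sub (η := θ))) (fun x => by
      rw [putPotential_sub hν hθν]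
      have := hηθ.putPotential_le hη hθ x
      linarith) k
    rw [putPotential_sub hν hθν] at h1
    rw [hσ]
    linarith
  · rw [putPotential_sub hν hσν, hσ]
    ring

theorem isShadow_shadow {η ν : Measure ℝ} (hη : FiniteFirstMoment η) (hν : FiniteFirstMoment ν)
    (hm : η.real univ ≤ ν.real univ) (hP : ∀ k, putPotential η k ≤ putPotential ν k) :
    IsShadow η ν (shadow η ν) := by
  obtain ⟨σ, hσ, -⟩ := exists_isShadow hη hν hm hP
  have hex : ∃ σ, IsShadow η ν σ := ⟨σ, hσ⟩
  rw [shadow, dif_pos hex]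
  exact hex.choose_spec

theorem putPotential_sub_shadow {η ν : Measure ℝ} (hη : FiniteFirstMoment η)
    (hν : FiniteFirstMoment ν) (hm : η.real univ ≤ ν.real univ)
    (hP : ∀ k, putPotential η k ≤ putPotential ν k) (k : ℝ) :
    putPotential (ν - shadow η ν) k =
      convexEnvelope (fun k => putPotential ν k - putPotential η k) k := by
  obtain ⟨σ, hσ, e⟩ := exists_isShadow hη hν hm hP
  have hs := isShadow_shadow hη hν hm hP
  rw [← e, putPotential_sub hν hs.1.2.2, putPotential_sub hν hσ.1.2.2]
  have h1 := (hs.2 σ hσ.1).putPotential_le hs.1.1 hσ.1.1 k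
  have h2 := (hσ.2 _ hs.1).putPotential_le hσ.1.1 hs.1.1 k
  linarith

/-! ### The quantile function and the upper part of a measure -/

theorem quantile_mono (μ : Measure ℝ) : Monotone (quantile μ) := by
  intro p p' h
  exact sInf_le_sInf (image_mono fun k (hk : p' < _) => lt_of_le_of_lt h hk)

theorem le_of_lt_quantile {μ : Measure ℝ} {p x : ℝ} (h : (x : EReal) < quantile μ p) :
    μ.real (Iic x) ≤ p := by
  by_contra! hlt
  exact absurd h (not_lt.2 (sInf_le ⟨x, hlt, rfl⟩))

theorem lt_of_quantile_lt {μ : Measure ℝ} [IsFiniteMeasure μ] {p x : ℝ}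
    (h : quantile μ p < x) : p < μ.real (Iic x) := by
  obtain ⟨_, ⟨k, hk, rfl⟩, hkx⟩ := sInf_lt_iff.1 h
  exact lt_of_lt_of_le hk
    (measureReal_mono (Iic_subset_Iic.2 (EReal.coe_lt_coe_iff.1 hkx).le))

theorem quantile_one (μ : Measure ℝ) [IsProbabilityMeasure μ] : quantile μ 1 = ⊤ := by
  have : {k : ℝ | 1 < μ.real (Iic k)} = ∅ :=
    eq_empty_of_forall_notMem fun k hk => absurd hk (not_lt.2 measureReal_le_one)
  rw [quantile, this, image_empty, sInf_empty]

theorem quantile_ne_top {μ : Measure ℝ} [IsProbabilityMeasure μ] {p : ℝ} (hp : p < 1) :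
    quantile μ p ≠ ⊤ := by
  obtain ⟨k, hk⟩ := ((ProbabilityTheory.tendsto_cdf_atTop μ).eventually (lt_mem_nhds hp)).exists
  rw [ProbabilityTheory.cdf_eq_real] at hk
  exact ne_top_of_le_ne_top (EReal.coe_ne_top k) (sInf_le ⟨k, hk, rfl⟩)

theorem quantile_ne_bot {μ : Measure ℝ} [IsProbabilityMeasure μ] {p : ℝ} (hp : 0 < p) :
    quantile μ p ≠ ⊥ := by
  obtain ⟨k, hk⟩ := ((ProbabilityTheory.tendsto_cdf_atBot μ).eventually (gt_mem_nhds hp)).exists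
  rw [ProbabilityTheory.cdf_eq_real] at hk
  intro h
  exact absurd (lt_of_quantile_lt (x := k) (by rw [h]; exact EReal.bot_lt_coe k)) (not_lt.2 hk.le)

theorem measureReal_Ioi_le_of_quantile {μ : Measure ℝ} [IsProbabilityMeasure μ] {p q : ℝ}
    (hq : quantile μ p = q) : μ.real (Ioi q) ≤ 1 - p := by
  have h1 : p ≤ μ.real (Iic q) := by
    rw [← ProbabilityTheory.cdf_eq_real]
    refine ge_of_tendsto (((ProbabilityTheory.cdf μ).right_continuous q).mono_left
      (nhdsWithin_mono q Ioi_subset_Ici_self)) ?_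
    filter_upwards [self_mem_nhdsWithin] with x hx
    rw [ProbabilityTheory.cdf_eq_real]
    exact (lt_of_quantile_lt (by rw [hq]; exact EReal.coe_lt_coe_iff.2 hx)).le
  have h2 := probReal_compl_eq_one_sub (μ := μ) (measurableSet_Iic (a := q))
  rw [compl_Iic] at h2
  linarith

theorem le_measureReal_Ici_of_quantile {μ : Measure ℝ} [IsProbabilityMeasure μ] {p q : ℝ}
    (hp : 0 ≤ p) (hq : quantile μ p = q) : 1 - p ≤ μ.real (Ici q) := by
  have h1 : μ (Iio q) ≤ ENNReal.ofReal p := by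
    conv_lhs => rw [← ProbabilityTheory.measure_cdf μ]
    rw [StieltjesFunction.measure_Iio _ (ProbabilityTheory.tendsto_cdf_atBot μ), sub_zero]
    refine ENNReal.ofReal_le_ofReal (le_of_tendsto
      ((ProbabilityTheory.monotone_cdf μ).tendsto_leftLim q) ?_)
    filter_upwards [self_mem_nhdsWithin] with x hx
    rw [ProbabilityTheory.cdf_eq_real]
    exact le_of_lt_quantile (by rw [hq]; exact EReal.coe_lt_coe_iff.2 hx)
  have h3 : μ.real (Iio q) ≤ p := ENNReal.toReal_le_of_le_ofReal hp h1
  have h2 := probReal_compl_eq_one_sub (μ := μ) (measurableSet_Iio (a := q))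
  rw [compl_Iio] at h2
  linarith

theorem upperPart_of_top {μ : Measure ℝ} {u : ℝ} (hu : u ≤ 0) (h : quantile μ (1 - u) = ⊤) :
    upperPart μ u = 0 := by
  have : {x : ℝ | quantile μ (1 - u) < (x : EReal)} = ∅ :=
    eq_empty_of_forall_notMem fun x hx => by
      have : quantile μ (1 - u) < (x : EReal) := hx
      rw [h] at this; exact not_top_lt this
  rw [upperPart, this]
  simp [ENNReal.ofReal_of_nonpos hu]

theorem upperPart_of_bot {μ : Measure ℝ} [IsProbabilityMeasure μ] {u : ℝ} (hu : u ≤ 1)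
    (h : quantile μ (1 - u) = ⊥) : upperPart μ u = μ := by
  have : {x : ℝ | quantile μ (1 - u) < (x : EReal)} = univ :=
    eq_univ_of_forall fun x => by
      show quantile μ (1 - u) < (x : EReal)
      rw [h]; exact EReal.bot_lt_coe x
  rw [upperPart, this]
  simp [ENNReal.ofReal_of_nonpos (sub_nonpos.2 hu)]

theorem upperPart_of_coe {μ : Measure ℝ} {u q : ℝ} (h : quantile μ (1 - u) = q) :
    upperPart μ u = μ.restrict (Ioi q) +
      ENNReal.ofReal (u - μ.real (Ioi q)) • Measure.dirac q := by
  have : {x : ℝ | quantile μ (1 - u) < (x : EReal)} = Ioi q := by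
    ext x
    show quantile μ (1 - u) < (x : EReal) ↔ q < x
    rw [h, EReal.coe_lt_coe_iff]
  rw [upperPart, this, h, EReal.toReal_coe]

theorem upperPart_le_restrict_Ici {μ : Measure ℝ} [IsProbabilityMeasure μ] {u q : ℝ} (hu : u ≤ 1)
    (h : quantile μ (1 - u) = q) : upperPart μ u ≤ μ.restrict (Ici q) := by
  have h1 : u ≤ μ.real (Ici q) := by
    have := le_measureReal_Ici_of_quantile (sub_nonneg.2 hu) h
    linarith
  have hd : Disjoint (Ioi q) {q} := by simp
  have hU : Ioi q ∪ {q} = Ici q := by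
    rw [union_comm]; ext x; simp [le_iff_lt_or_eq, or_comm]
  rw [upperPart_of_coe h, ← hU, Measure.restrict_union hd (measurableSet_singleton q),
    Measure.restrict_singleton]
  refine add_le_add le_rfl ?_
  have h2 : μ.real (Ici q) = μ.real (Ioi q) + μ.real {q} := by
    rw [← hU, measureReal_union hd (measurableSet_singleton q)]
  have h3 : ENNReal.ofReal (u - μ.real (Ioi q)) ≤ μ {q} := by
    rw [← ofReal_measureReal (μ := μ) (s := {q})]
    exact ENNReal.ofReal_le_ofReal (by linarith)
  intro s
  simp only [Measure.smul_apply, smul_eq_mul]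
  gcongr

theorem restrict_Ioi_le_upperPart {μ : Measure ℝ} {u q : ℝ}
    (h : quantile μ (1 - u) = q) : μ.restrict (Ioi q) ≤ upperPart μ u := by
  rw [upperPart_of_coe h]
  exact Measure.le_add_right le_rfl

theorem eq_zero_of_quantile_eq_top {μ : Measure ℝ} [IsProbabilityMeasure μ] {u : ℝ}
    (hu : 0 ≤ u) (h : quantile μ (1 - u) = ⊤) : u = 0 := by
  by_contra h0
  have : 0 < u := lt_of_le_of_ne hu (Ne.symm h0)
  exact quantile_ne_top (by linarith) h

theorem eq_one_of_quantile_eq_bot {μ : Measure ℝ} [IsProbabilityMeasure μ] {u : ℝ}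
    (hu : u ≤ 1) (h : quantile μ (1 - u) = ⊥) : u = 1 := by
  by_contra h0
  have : u < 1 := lt_of_le_of_ne hu h0
  exact quantile_ne_bot (by linarith) h

theorem upperPart_le {μ : Measure ℝ} [IsProbabilityMeasure μ] {u : ℝ} (hu : u ∈ Icc (0 : ℝ) 1) :
    upperPart μ u ≤ μ := by
  induction h : quantile μ (1 - u) with
  | bot => rw [upperPart_of_bot hu.2 h]
  | top =>
    rw [upperPart_of_top (eq_zero_of_quantile_eq_top hu.1 h).le h]
    exact Measure.zero_le μ
  | coe q => exact (upperPart_le_restrict_Ici hu.2 h).trans Measure.restrict_le_self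

theorem upperPart_mono {μ : Measure ℝ} [IsProbabilityMeasure μ] {u v : ℝ}
    (hu : u ∈ Icc (0 : ℝ) 1) (hv : v ∈ Icc (0 : ℝ) 1) (huv : u ≤ v) :
    upperPart μ u ≤ upperPart μ v := by
  have hq : quantile μ (1 - v) ≤ quantile μ (1 - u) := quantile_mono μ (by linarith)
  induction hqu : quantile μ (1 - u) with
  | top =>
    rw [upperPart_of_top (eq_zero_of_quantile_eq_top hu.1 hqu).le hqu]
    exact Measure.zero_le _
  | bot =>
    rw [hqu, le_bot_iff] at hq
    rw [upperPart_of_bot hu.2 hqu, upperPart_of_bot hv.2 hq]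
  | coe q =>
    induction hqv : quantile μ (1 - v) with
    | top => rw [hqu, hqv, top_le_iff] at hq; exact absurd hq (EReal.coe_ne_top q)
    | bot => rw [upperPart_of_bot hv.2 hqv]; exact upperPart_le hu
    | coe r =>
      rw [hqu, hqv, EReal.coe_le_coe_iff] at hq
      rcases eq_or_lt_of_le hq with rfl | hlt
      · rw [upperPart_of_coe hqu, upperPart_of_coe hqv]
        refine add_le_add le_rfl fun s => ?_
        simp only [Measure.smul_apply, smul_eq_mul]
        gcongr
      · exact (upperPart_le_restrict_Ici hu.2 hqu).trans
          ((Measure.restrict_mono (Ici_subset_Ioi.2 hlt) le_rfl).trans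
            (restrict_Ioi_le_upperPart hqv))

theorem measureReal_upperPart_univ {μ : Measure ℝ} [IsProbabilityMeasure μ] {u : ℝ}
    (hu : u ∈ Icc (0 : ℝ) 1) : (upperPart μ u).real univ = u := by
  induction h : quantile μ (1 - u) with
  | bot =>
    rw [upperPart_of_bot hu.2 h, eq_one_of_quantile_eq_bot hu.2 h]; simp
  | top =>
    have h0 := eq_zero_of_quantile_eq_top hu.1 h
    rw [upperPart_of_top h0.le h, h0]; simp
  | coe q =>
    have h1 := measureReal_Ioi_le_of_quantile h
    rw [upperPart_of_coe h, measureReal_add_apply (h₂ := by simp),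
      measureReal_ennreal_smul_apply, ENNReal.toReal_ofReal (by linarith)]
    simp

/-- If `G(1-u) = G(1-v) = q`, then `μ_u` and `μ_v` differ by an atom at `q`. -/
theorem callPotential_upperPart_sub {μ : Measure ℝ} [IsProbabilityMeasure μ]
    (hμ : FiniteFirstMoment μ) {u v q : ℝ} (huv : u ≤ v)
    (hqu : quantile μ (1 - u) = q) (hqv : quantile μ (1 - v) = q) (k : ℝ) :
    callPotential (upperPart μ v) k - callPotential (upperPart μ u) k =
      (v - u) * max (q - k) 0 := by
  have h1 := measureReal_Ioi_le_of_quantile hqu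
  have key : ∀ c : ℝ, 0 ≤ c →
      callPotential (μ.restrict (Ioi q) + ENNReal.ofReal c • Measure.dirac q) k =
      callPotential (μ.restrict (Ioi q)) k + c * max (q - k) 0 := fun c hc => by
    have hi : Integrable (fun x => max (x - k) 0) (ENNReal.ofReal c • Measure.dirac q) :=
      Integrable.smul_measure (integrable_dirac (by simp)) ENNReal.ofReal_ne_top
    rw [callPotential, integral_add_measure
      ((hμ.integrable_call k).mono_measure Measure.restrict_le_self) hi, integral_smul_measure,
      integral_dirac, ENNReal.toReal_ofReal hc]
    rfl
  rw [upperPart_of_coe hqu, upperPart_of_coe hqv, key _ (by linarith), key _ (by linarith)]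
  ring

/-! ### The functions `𝓔_u` and their hulls -/

section Hulls

variable {μ ν : Measure ℝ}

theorem calE_nonneg [IsProbabilityMeasure μ] (hμ : FiniteFirstMoment μ) (hν : FiniteFirstMoment ν)
    (hμν : ConvexDecreasingLE μ ν) {u : ℝ} (hu : u ∈ Icc (0 : ℝ) 1) (k : ℝ) :
    0 ≤ calE μ ν u k := by
  have h1 := hμν.putPotential_le hμ hν k
  have h2 := callPotential_nonneg (μ - upperPart μ u) k
  rw [callPotential_sub hμ (upperPart_le hu)] at h2
  rw [calE, potentialGap]
  linarith

theorem exists_convexOn_le_calE [IsProbabilityMeasure μ]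
    (hμ : FiniteFirstMoment μ) (hν : FiniteFirstMoment ν)
    (hμν : ConvexDecreasingLE μ ν) {u : ℝ} (hu : u ∈ Icc (0 : ℝ) 1) :
    ∃ h : ℝ → ℝ, ConvexOn ℝ univ h ∧ ∀ k, h k ≤ calE μ ν u k :=
  ⟨fun _ => 0, convexOn_const 0 convex_univ, calE_nonneg hμ hν hμν hu⟩

theorem convexOn_calEHull [IsProbabilityMeasure μ]
    (hμ : FiniteFirstMoment μ) (hν : FiniteFirstMoment ν)
    (hμν : ConvexDecreasingLE μ ν) {u : ℝ} (hu : u ∈ Icc (0 : ℝ) 1) :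
    ConvexOn ℝ univ (calEHull μ ν u) :=
  convexOn_convexEnvelope (exists_convexOn_le_calE hμ hν hμν hu)

theorem calEHull_nonneg [IsProbabilityMeasure μ]
    (hμ : FiniteFirstMoment μ) (hν : FiniteFirstMoment ν)
    (hμν : ConvexDecreasingLE μ ν) {u : ℝ} (hu : u ∈ Icc (0 : ℝ) 1) (k : ℝ) :
    0 ≤ calEHull μ ν u k :=
  le_convexEnvelope (f := calE μ ν u) (convexOn_const 0 convex_univ) (calE_nonneg hμ hν hμν hu) k

theorem calE_eq_sub (μ ν : Measure ℝ) (u v : ℝ) : calE μ ν v = fun k => calE μ ν u k -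
    (callPotential (upperPart μ v) k - callPotential (upperPart μ u) k) := by
  funext k
  simp only [calE]; ring

theorem calE_eq_putPotential [IsProbabilityMeasure μ]
    (hμ : FiniteFirstMoment μ) {u : ℝ} (hu : u ∈ Icc (0 : ℝ) 1) :
    calE μ ν u = fun k => (putPotential ν k - putPotential (upperPart μ u) k) +
      ((u - 1) * k + ((∫ x, x ∂μ) - ∫ x, x ∂(upperPart μ u))) := by
  funext k
  have h1 := callPotential_eq hμ k
  have h2 := callPotential_eq (hμ.mono (upperPart_le hu)) k
  rw [measureReal_upperPart_univ hu] at h2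
  rw [probReal_univ] at h1
  rw [calE, potentialGap, h1, h2]; ring

/-- The call potential of `ν - S^ν(μ_u)` is `𝓔_u^c` up to a constant. -/
theorem exists_callPotential_remaining_eq [IsProbabilityMeasure μ] [IsProbabilityMeasure ν]
    (hμ : FiniteFirstMoment μ) (hν : FiniteFirstMoment ν)
    (hμν : ConvexDecreasingLE μ ν) {u : ℝ} (hu : u ∈ Icc (0 : ℝ) 1) :
    ∃ c, ∀ k, callPotential (ν - shadow (upperPart μ u) ν) k = calEHull μ ν u k - c := by
  have hη := hμ.mono (upperPart_le hu)
  have hle := upperPart_le (μ := μ) hu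
  have hP : ∀ k, putPotential (upperPart μ u) k ≤ putPotential ν k := fun k => by
    have h1 := putPotential_nonneg (μ - upperPart μ u) k
    rw [putPotential_sub hμ hle] at h1
    have h2 := hμν.putPotential_le hμ hν k
    linarith
  have hm : (upperPart μ u).real univ ≤ ν.real univ := by
    rw [measureReal_upperPart_univ hu, probReal_univ]; exact hu.2
  have hs := isShadow_shadow hη hν hm hP
  have hmass : (ν - shadow (upperPart μ u) ν).real univ = 1 - u := by
    have h1 := hs.1.2.1.measureReal_univ_eq hη hs.1.1
    rw [measureReal_upperPart_univ hu] at h1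
    have := hs.1.1.1
    have h2 : (ν - shadow (upperPart μ u) ν + shadow (upperPart μ u) ν).real univ = 1 := by
      rw [Measure.sub_add_cancel_of_le hs.1.2.2, probReal_univ]
    rw [measureReal_add_apply] at h2
    linarith
  have hhull : ∀ k, calEHull μ ν u k = putPotential (ν - shadow (upperPart μ u) ν) k +
      ((u - 1) * k + ((∫ x, x ∂μ) - ∫ x, x ∂(upperPart μ u))) := fun k => by
    rw [putPotential_sub_shadow hη hν hm hP, calEHull, calE_eq_putPotential hμ hu]
    exact convexEnvelope_add_affine ⟨fun _ => 0, convexOn_const 0 convex_univ,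
      fun x => sub_nonneg.2 (hP x)⟩ _ _ k
  refine ⟨((∫ x, x ∂μ) - ∫ x, x ∂(upperPart μ u)) -
    ∫ x, x ∂(ν - shadow (upperPart μ u) ν), fun k => ?_⟩
  rw [callPotential_eq hν.sub, hmass, hhull]; ring

theorem calEHull_zero [IsProbabilityMeasure μ] [IsProbabilityMeasure ν]
    (hμ : FiniteFirstMoment μ) (hν : FiniteFirstMoment ν) (k : ℝ) :
    calEHull μ ν 0 k = callPotential ν k + ((∫ x, x ∂μ) - ∫ x, x ∂ν) := by
  have h0 : upperPart μ 0 = 0 :=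
    upperPart_of_top le_rfl (by rw [sub_zero]; exact quantile_one μ)
  have e : calE μ ν 0 = fun k => callPotential ν k + ((∫ x, x ∂μ) - ∫ x, x ∂ν) := by
    funext k
    have h1 := callPotential_eq hμ k
    have h2 := callPotential_eq hν k
    rw [probReal_univ] at h1 h2
    have h3 : callPotential (0 : Measure ℝ) k = 0 := by simp [callPotential]
    rw [calE, potentialGap, h0, h1, h2, h3]; ring
  have hc : ConvexOn ℝ univ fun k => callPotential ν k + ((∫ x, x ∂μ) - ∫ x, x ∂ν) :=
    (convexOn_callPotential hν).add (convexOn_const _ convex_univ)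
  rw [calEHull, e, convexEnvelope_eq_self hc]

/-- If `G(0) = -∞`, then `𝓔_1 = P_ν - P_μ` is bounded and vanishes at `-∞`, so that its hull
is zero. -/
theorem calEHull_eq_zero_of_bot [IsProbabilityMeasure μ] [IsProbabilityMeasure ν]
    (hμ : FiniteFirstMoment μ) (hν : FiniteFirstMoment ν)
    (hμν : ConvexDecreasingLE μ ν) {u : ℝ} (hu : u ∈ Icc (0 : ℝ) 1)
    (hq : quantile μ (1 - u) = ⊥) (k : ℝ) : calEHull μ ν u k = 0 := by
  have hc := convexOn_calEHull hμ hν hμν hu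
  have hle : ∀ x, calEHull μ ν u x ≤ putPotential ν x - putPotential μ x := fun x => by
    refine (convexEnvelope_le (exists_convexOn_le_calE hμ hν hμν hu) x).trans (le_of_eq ?_)
    rw [calE, potentialGap, upperPart_of_bot hu.2 hq]; ring
  have h0 := calEHull_nonneg hμ hν hμν hu
  have hbdd : ∀ x, 0 ≤ x → calEHull μ ν u x ≤ putPotential ν 0 + |∫ x, x ∂μ| := fun x hx => by
    have h1 := putPotential_le_linear hν hx
    have h2 := callPotential_eq hμ x
    have h3 := callPotential_nonneg μ x
    rw [probReal_univ] at h1 h2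
    have := hle x
    have := le_abs_self (∫ x, x ∂μ)
    linarith
  refine le_antisymm ?_ (h0 k)
  by_contra! hpos
  obtain ⟨a, ha, hak⟩ : ∃ a, putPotential ν a < calEHull μ ν u k ∧ a < k :=
    (((tendsto_putPotential_atBot hν).eventually (gt_mem_nhds hpos)).and
      (eventually_lt_atBot k)).exists
  have hac : calEHull μ ν u a < calEHull μ ν u k := by
    have := hle a
    have := putPotential_nonneg μ a
    linarith
  -- the chord from `a` to `k` has positive slope, so that the hull would tend to infinity
  set s := (calEHull μ ν u k - calEHull μ ν u a) / (k - a) with hs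
  have hs0 : 0 < s := div_pos (by linarith) (by linarith)
  set x := max (max 0 k) (k + (putPotential ν 0 + |∫ x, x ∂μ|) / s) with hx
  have hxk : k ≤ x := (le_max_right 0 k).trans (le_max_left _ _)
  have hx0 : 0 ≤ x := (le_max_left 0 k).trans (le_max_left _ _)
  have h1 := chord_of_convexOn hc (mem_univ a) (mem_univ x) hak.le hxk
  have h2 : (putPotential ν 0 + |∫ x, x ∂μ|) / s ≤ x - k := by
    have := le_max_right (max 0 k) (k + (putPotential ν 0 + |∫ x, x ∂μ|) / s)
    linarith
  rw [div_le_iff₀ hs0] at h2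
  have h3 : s * (k - a) = calEHull μ ν u k - calEHull μ ν u a := by
    rw [hs]; exact div_mul_cancel₀ _ (by linarith)
  have h4 : (k - a) * calEHull μ ν u x ≥ (k - a) * (calEHull μ ν u k + s * (x - k)) := by
    linear_combination h1 + (x - k) * h3
  have h5 := le_of_mul_le_mul_left h4 (by linarith)
  have h6 := hbdd x hx0
  linarith

/-- The support line is a line below the hull, also where it is a horizontal asymptote. -/
theorem exists_supportLine_eq [IsProbabilityMeasure μ] [IsProbabilityMeasure ν]
    (hμ : FiniteFirstMoment μ) (hν : FiniteFirstMoment ν)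
    (hμν : ConvexDecreasingLE μ ν) {u : ℝ} (hu : u ∈ Icc (0 : ℝ) 1) :
    ∃ m c : ℝ, (∀ x, supportLine μ ν u x = m * x + c) ∧
      ∀ x, m * x + c ≤ calEHull μ ν u x := by
  induction hq : quantile μ (1 - u) with
  | bot =>
    have h0 : calEHull μ ν u = fun _ => 0 :=
      funext (calEHull_eq_zero_of_bot hμ hν hμν hu hq)
    refine ⟨0, 0, fun x => ?_, fun x => by simp [h0]⟩
    rw [supportLine, if_neg (by rw [hq]; exact bot_ne_top), if_pos hq, h0,
      (tendsto_const_nhds (x := (0 : ℝ)) (f := (atBot : Filter ℝ))).limUnder_eq]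
    simp
  | top =>
    obtain rfl := eq_zero_of_quantile_eq_top hu.1 hq
    have h1 : Tendsto (calEHull μ ν 0) atTop (nhds ((∫ x, x ∂μ) - ∫ x, x ∂ν)) := by
      have : calEHull μ ν 0 = fun k => callPotential ν k + ((∫ x, x ∂μ) - ∫ x, x ∂ν) :=
        funext (calEHull_zero hμ hν)
      rw [this]
      simpa using (tendsto_callPotential_atTop hν).add_const ((∫ x, x ∂μ) - ∫ x, x ∂ν)
    refine ⟨0, (∫ x, x ∂μ) - ∫ x, x ∂ν, fun x => ?_, fun x => ?_⟩
    · rw [supportLine, if_pos hq, h1.limUnder_eq]; ring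
    · rw [calEHull_zero hμ hν]
      have := callPotential_nonneg ν x
      linarith
  | coe q =>
    refine ⟨phi μ ν u, calEHull μ ν u q - phi μ ν u * q, fun x => ?_, fun x => ?_⟩
    · rw [supportLine, hq, if_neg (EReal.coe_ne_top q), if_neg (EReal.coe_ne_bot q),
        EReal.toReal_coe]
      ring
    · have := sSup_mem_subdifferential (convexOn_calEHull hμ hν hμν hu) q x
      rw [phi, hq, EReal.toReal_coe]
      linarith

theorem supportLine_of_coe {u q : ℝ} (hq : quantile μ (1 - u) = q) (x : ℝ) :
    supportLine μ ν u x = calEHull μ ν u q +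
      sSup (subdifferential (calEHull μ ν u) q) * (x - q) := by
  rw [supportLine, phi, hq, if_neg (EReal.coe_ne_top q), if_neg (EReal.coe_ne_bot q),
    EReal.toReal_coe]

theorem calEHull_eq_supportLine_of_coe {u q : ℝ} (hq : quantile μ (1 - u) = q) :
    calEHull μ ν u q = supportLine μ ν u q := by
  rw [supportLine_of_coe hq]; ring

/-- If `𝓔_u^c` is affine on an interval which contains `G(1-u)` and a point to the right of it,
then it coincides there with its support line. -/
theorem contact_of_affine_on [IsProbabilityMeasure μ] [IsProbabilityMeasure ν]
    (hμ : FiniteFirstMoment μ) (hν : FiniteFirstMoment ν)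
    (hμν : ConvexDecreasingLE μ ν) {u : ℝ} (hu : u ∈ Icc (0 : ℝ) 1) {q a b m c : ℝ}
    (hq : quantile μ (1 - u) = q) (haq : a ≤ q) (hqb : q < b)
    (h : ∀ x ∈ Icc a b, calEHull μ ν u x = m * x + c) :
    ∀ x ∈ Icc a b, calEHull μ ν u x = supportLine μ ν u x := by
  have hc := convexOn_calEHull hμ hν hμν hu
  have hqe := h q ⟨haq, hqb.le⟩
  have hbe := h b ⟨haq.trans hqb.le, le_rfl⟩
  have hm : m ∈ subdifferential (calEHull μ ν u) q := fun y => by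
    have := affine_le_of_convexOn hc (haq.trans_lt hqb) h y
    linarith
  have h1 : m ≤ sSup (subdifferential (calEHull μ ν u) q) :=
    le_csSup (subdifferential_bddAbove _ _) hm
  have h2 := sSup_mem_subdifferential hc q b
  rw [hqe, hbe] at h2
  have h3 : sSup (subdifferential (calEHull μ ν u) q) ≤ m :=
    le_of_mul_le_mul_right (a := b - q) (by linarith) (by linarith)
  intro x hx
  rw [supportLine_of_coe hq, h x hx, hqe, le_antisymm h3 h1]
  ring

/-- Between two contact points of `𝓔_u^c` with its support line, `𝓔_v^c` is affine for `v > u`. -/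
theorem calEHull_affine_on_of_contact [IsProbabilityMeasure μ] [IsProbabilityMeasure ν]
    (hμ : FiniteFirstMoment μ) (hν : FiniteFirstMoment ν)
    (hμν : ConvexDecreasingLE μ ν) {u v : ℝ} (hu : u ∈ Icc (0 : ℝ) 1) (hv : v ∈ Icc (0 : ℝ) 1)
    (huv : u ≤ v) {a b : ℝ} (hab : a < b) (ha : calEHull μ ν u a = supportLine μ ν u a)
    (hb : calEHull μ ν u b = supportLine μ ν u b) :
    ∃ m c : ℝ, ∀ x ∈ Icc a b, calEHull μ ν v x = m * x + c := by
  obtain ⟨m, c, hL, hle⟩ := exists_supportLine_eq hμ hν hμν hu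
  have h1 := eq_affine_of_contact (convexOn_calEHull hμ hν hμν hu) hab.le hle
    (by rw [ha, hL]) (by rw [hb, hL])
  have hψ : ConvexOn ℝ univ
      (fun k => callPotential (upperPart μ v) k - callPotential (upperPart μ u) k) := by
    have hv' := hμ.mono (upperPart_le hv)
    refine (convexOn_callPotential (hv'.sub (η := upperPart μ u))).congr fun k _ => ?_
    exact callPotential_sub hv' (upperPart_mono hu hv huv) k
  have hex := exists_convexOn_le_calE hμ hν hμν hv
  rw [calE_eq_sub μ ν u v] at hex
  obtain ⟨m', c', h2⟩ := convexEnvelope_sub_affine_on hψ hex hab h1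
  refine ⟨m', c', fun x hx => ?_⟩
  rw [calEHull, calE_eq_sub μ ν u v]
  exact h2 x hx

/-- For `G(1-u) = ∞` the contact set is closed under going to the right. -/
theorem contact_of_le_of_top [IsProbabilityMeasure μ] [IsProbabilityMeasure ν]
    (hμ : FiniteFirstMoment μ) (hν : FiniteFirstMoment ν)
    (hμν : ConvexDecreasingLE μ ν) {u : ℝ} (hu : u ∈ Icc (0 : ℝ) 1)
    (hq : quantile μ (1 - u) = ⊤) {a b : ℝ} (hab : a ≤ b)
    (ha : calEHull μ ν u a = supportLine μ ν u a) :
    calEHull μ ν u b = supportLine μ ν u b := by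
  have hle' : supportLine μ ν u b ≤ calEHull μ ν u b := by
    obtain ⟨m, c, hL, hle⟩ := exists_supportLine_eq hμ hν hμν hu
    rw [hL]; exact hle b
  have hconst : supportLine μ ν u b = supportLine μ ν u a := by
    simp only [supportLine, if_pos hq]
  refine le_antisymm ?_ hle'
  rw [hconst, ← ha]
  obtain rfl := eq_zero_of_quantile_eq_top hu.1 hq
  rw [calEHull_zero hμ hν, calEHull_zero hμ hν]
  have : callPotential ν b ≤ callPotential ν a :=
    integral_mono (hν.integrable_call b) (hν.integrable_call a)
      fun x => max_le_max (by linarith) le_rfl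
  linarith

/-- A point left of `G(1-v)` where `𝓔_u^c` touches its support line is, for `v > u`, also a
point where `𝓔_v^c` touches its own. -/
theorem contact_of_lt_quantile [IsProbabilityMeasure μ] [IsProbabilityMeasure ν]
    (hμ : FiniteFirstMoment μ) (hν : FiniteFirstMoment ν)
    (hμν : ConvexDecreasingLE μ ν) {u v : ℝ} (hu : u ∈ Icc (0 : ℝ) 1) (hv : v ∈ Icc (0 : ℝ) 1)
    (huv : u < v) {a q : ℝ} (hq : quantile μ (1 - v) = q) (haq : a < q)
    (ha : calEHull μ ν u a = supportLine μ ν u a) :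
    calEHull μ ν v a = supportLine μ ν v a := by
  have hmono : quantile μ (1 - v) ≤ quantile μ (1 - u) := quantile_mono μ (by linarith)
  have wide : ∀ b, q < b → calEHull μ ν u b = supportLine μ ν u b →
      calEHull μ ν v a = supportLine μ ν v a := fun b hb hb' => by
    obtain ⟨m, c, h⟩ := calEHull_affine_on_of_contact hμ hν hμν hu hv huv.le (haq.trans hb) ha hb'
    exact contact_of_affine_on hμ hν hμν hv hq haq.le hb h a ⟨le_rfl, (haq.trans hb).le⟩
  induction hqu : quantile μ (1 - u) with
  | bot =>
    rw [hq, hqu, le_bot_iff] at hmono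
    exact absurd hmono (EReal.coe_ne_bot q)
  | top =>
    exact wide (q + 1) (by linarith)
      (contact_of_le_of_top hμ hν hμν hu hqu (by linarith) ha)
  | coe r =>
    rw [hq, hqu, EReal.coe_le_coe_iff] at hmono
    rcases eq_or_lt_of_le hmono with rfl | hlt
    · have e : calE μ ν v = fun k => calE μ ν u k - (v - u) * max (q - k) 0 := by
        rw [calE_eq_sub μ ν u v]
        funext k
        rw [callPotential_upperPart_sub hμ huv.le hqu hq]
      have hex := exists_convexOn_le_calE hμ hν hμν hv
      rw [supportLine_of_coe hqu] at ha
      rw [supportLine_of_coe hq]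
      simp only [calEHull, e] at hex ⊢
      exact convexEnvelope_sub_put_eq haq (sub_pos.2 huv) hex ha
    · exact wide r hlt (calEHull_eq_supportLine_of_coe hqu)

/-! ### Upper end of the support of a measure -/

theorem sSup_support_le_iff {η : Measure ℝ} (hη : FiniteFirstMoment η) (x : ℝ) :
    sSup (Real.toEReal '' η.support) ≤ x ↔ callPotential η x = 0 := by
  rw [callPotential_eq_zero_iff hη]
  constructor
  · intro h
    refine measure_mono_null (fun y hy => ?_) (Measure.measure_compl_support (μ := η))
    intro hy'
    have := (le_sSup (mem_image_of_mem _ hy')).trans h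
    exact absurd hy (not_lt.2 (EReal.coe_le_coe_iff.1 this))
  · intro h
    refine sSup_le ?_
    rintro _ ⟨y, hy, rfl⟩
    have := Measure.support_subset_of_isClosed (μ := η) (isClosed_Iic (a := x))
      (by rw [mem_ae_iff, compl_Iic]; exact h) hy
    exact EReal.coe_le_coe_iff.2 this

theorem sSup_remainingSupport_le_of_affine [IsProbabilityMeasure μ] [IsProbabilityMeasure ν]
    (hμ : FiniteFirstMoment μ) (hν : FiniteFirstMoment ν)
    (hμν : ConvexDecreasingLE μ ν) {u : ℝ} (hu : u ∈ Icc (0 : ℝ) 1) {x m c : ℝ}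
    (h : ∀ y, x ≤ y → calEHull μ ν u y = m * y + c) :
    sSup (Real.toEReal '' remainingSupport μ ν u) ≤ x := by
  have hρ : FiniteFirstMoment (ν - shadow (upperPart μ u) ν) := hν.sub
  obtain ⟨κ, hκ⟩ := exists_callPotential_remaining_eq hμ hν hμν hu
  have hlim := tendsto_callPotential_atTop hρ
  refine (sSup_support_le_iff hρ x).2 ?_
  have hval : ∀ y, x ≤ y →
      callPotential (ν - shadow (upperPart μ u) ν) y = m * y + c - κ := fun y hy => by
    rw [hκ, h y hy]
  have hm : m = 0 := by
    have h1 := (hlim.comp (tendsto_atTop_add_const_right _ 1 tendsto_id)).sub hlim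
    rw [sub_zero] at h1
    refine tendsto_nhds_unique (tendsto_const_nhds.congr' ?_) h1
    filter_upwards [eventually_ge_atTop x] with y hy
    simp only [Function.comp, id]
    rw [hval y hy, hval (y + 1) (by linarith)]; ring
  subst hm
  refine tendsto_nhds_unique (tendsto_const_nhds.congr' ?_) hlim
  filter_upwards [eventually_ge_atTop x] with y hy
  rw [hval y hy, hval x le_rfl]; ring

theorem exists_calEHull_eq_const [IsProbabilityMeasure μ] [IsProbabilityMeasure ν]
    (hμ : FiniteFirstMoment μ) (hν : FiniteFirstMoment ν)
    (hμν : ConvexDecreasingLE μ ν) {u : ℝ} (hu : u ∈ Icc (0 : ℝ) 1) {x : ℝ}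
    (h : sSup (Real.toEReal '' remainingSupport μ ν u) ≤ x) :
    ∃ c, ∀ y, x ≤ y → calEHull μ ν u y = c := by
  have hρ : FiniteFirstMoment (ν - shadow (upperPart μ u) ν) := hν.sub
  obtain ⟨κ, hκ⟩ := exists_callPotential_remaining_eq hμ hν hμν hu
  refine ⟨κ, fun y hy => ?_⟩
  have h1 := (sSup_support_le_iff hρ y).1 (h.trans (EReal.coe_le_coe_iff.2 hy))
  rw [hκ] at h1
  linarith

end Hulls

/-! ### Monotonicity of the bounds -/

section Bounds

variable {μ ν : Measure ℝ}

theorem lowerFn_le_of_contact {u x : ℝ} (hx : (x : EReal) ≤ quantile μ (1 - u))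
    (h : calEHull μ ν u x = supportLine μ ν u x) : lowerFn μ ν u ≤ x := by
  unfold lowerFn
  split_ifs
  · exact bot_le
  · exact sInf_le ⟨x, ⟨hx, h⟩, rfl⟩

theorem le_upperFn_of_contact {u x : ℝ} (hx : quantile μ (1 - u) ≤ x)
    (h : calEHull μ ν u x = supportLine μ ν u x) : (x : EReal) ≤ upperFn μ ν u := by
  unfold upperFn
  split_ifs
  · exact le_top
  · exact le_sSup ⟨x, ⟨hx, h⟩, rfl⟩

theorem lowerFn_le_quantile (u : ℝ) : lowerFn μ ν u ≤ quantile μ (1 - u) := by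
  induction hq : quantile μ (1 - u) with
  | bot => rw [lowerFn, if_pos hq]
  | top => exact le_top
  | coe q => exact lowerFn_le_of_contact hq.ge (calEHull_eq_supportLine_of_coe hq)

theorem quantile_le_upperFn (u : ℝ) : quantile μ (1 - u) ≤ upperFn μ ν u := by
  induction hq : quantile μ (1 - u) with
  | bot => exact bot_le
  | top => rw [upperFn, if_pos hq]
  | coe q => exact le_upperFn_of_contact hq.le (calEHull_eq_supportLine_of_coe hq)

theorem le_lowerFn [IsProbabilityMeasure μ] {u : ℝ} (hu : u < 1) {y : EReal}
    (h : ∀ a : ℝ, (a : EReal) ≤ quantile μ (1 - u) →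
      calEHull μ ν u a = supportLine μ ν u a → y ≤ a) : y ≤ lowerFn μ ν u := by
  rw [lowerFn, if_neg (quantile_ne_bot (by linarith))]
  refine le_sInf ?_
  rintro _ ⟨a, ⟨h1, h2⟩, rfl⟩
  exact h a h1 h2

theorem lowerFn_antitoneOn [IsProbabilityMeasure μ] [IsProbabilityMeasure ν]
    (hμ : FiniteFirstMoment μ) (hν : FiniteFirstMoment ν)
    (hμν : ConvexDecreasingLE μ ν) : AntitoneOn (lowerFn μ ν) (Icc (0 : ℝ) 1) := by
  intro u hu v hv huv
  rcases eq_or_lt_of_le huv with rfl | huv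
  · exact le_rfl
  refine le_lowerFn (huv.trans_le hv.2) fun a _ ha => ?_
  have hlow := lowerFn_le_quantile (μ := μ) (ν := ν) v
  induction hq : quantile μ (1 - v) with
  | bot =>
    rw [lowerFn, if_pos hq]
    exact bot_le
  | top =>
    have := eq_zero_of_quantile_eq_top hv.1 hq
    linarith [hu.1]
  | coe q =>
    rw [hq] at hlow
    rcases le_or_gt q a with h | h
    · exact hlow.trans (EReal.coe_le_coe_iff.2 h)
    · exact lowerFn_le_of_contact (by rw [hq]; exact EReal.coe_le_coe_iff.2 h.le)
        (contact_of_lt_quantile hμ hν hμν hu hv huv hq h ha)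

theorem exists_contact_of_lowerFn_lt [IsProbabilityMeasure μ] {u : ℝ} (hu : u < 1) {x : EReal}
    (hx : lowerFn μ ν u < x) : ∃ a : ℝ, a < x ∧ (a : EReal) ≤ quantile μ (1 - u) ∧
      calEHull μ ν u a = supportLine μ ν u a := by
  rw [lowerFn, if_neg (quantile_ne_bot (by linarith))] at hx
  obtain ⟨_, ⟨a, ⟨h1, h2⟩, rfl⟩, h3⟩ := sInf_lt_iff.1 hx
  exact ⟨a, h3, h1, h2⟩

theorem exists_contact_of_lt_upperFn [IsProbabilityMeasure μ] [IsProbabilityMeasure ν]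
    (hμ : FiniteFirstMoment μ) (hν : FiniteFirstMoment ν)
    (hμν : ConvexDecreasingLE μ ν) {u : ℝ} (hu : u ∈ Icc (0 : ℝ) 1) {a x : ℝ}
    (ha : calEHull μ ν u a = supportLine μ ν u a) (hx : x < upperFn μ ν u) :
    ∃ b : ℝ, x < b ∧ calEHull μ ν u b = supportLine μ ν u b := by
  by_cases hq : quantile μ (1 - u) = ⊤
  · exact ⟨max a (x + 1), lt_of_lt_of_le (by linarith) (le_max_right _ _),
      contact_of_le_of_top hμ hν hμν hu hq (le_max_left _ _) ha⟩
  · rw [upperFn, if_neg hq] at hx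
    obtain ⟨_, ⟨b, ⟨-, h2⟩, rfl⟩, h3⟩ := lt_sSup_iff.1 hx
    exact ⟨b, EReal.coe_lt_coe_iff.1 h3, h2⟩

theorem upperFn_of_bot [IsProbabilityMeasure μ] [IsProbabilityMeasure ν]
    (hμ : FiniteFirstMoment μ) (hν : FiniteFirstMoment ν)
    (hμν : ConvexDecreasingLE μ ν) {u : ℝ} (hu : u ∈ Icc (0 : ℝ) 1)
    (hq : quantile μ (1 - u) = ⊥) : upperFn μ ν u = ⊤ := by
  refine (EReal.eq_top_iff_forall_lt _).2 fun y => ?_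
  refine lt_of_lt_of_le (EReal.coe_lt_coe_iff.2 (show y < y + 1 by linarith))
    (le_upperFn_of_contact (by rw [hq]; exact bot_le) ?_)
  have h0 : calEHull μ ν u = fun _ => 0 := funext (calEHull_eq_zero_of_bot hμ hν hμν hu hq)
  rw [supportLine, if_neg (by rw [hq]; exact bot_ne_top), if_pos hq, h0,
    (tendsto_const_nhds (x := (0 : ℝ)) (f := (atBot : Filter ℝ))).limUnder_eq]

theorem upperFn_notMem_Ioo [IsProbabilityMeasure μ] [IsProbabilityMeasure ν]
    (hμ : FiniteFirstMoment μ) (hν : FiniteFirstMoment ν)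
    (hμν : ConvexDecreasingLE μ ν) {u v : ℝ} (hu : u ∈ Icc (0 : ℝ) 1) (hv : v ∈ Icc (0 : ℝ) 1)
    (huv : u < v) : upperFn μ ν v ∉ Ioo (lowerFn μ ν u) (upperFn μ ν u) := by
  rintro ⟨h1, h2⟩
  induction hq : quantile μ (1 - v) with
  | bot =>
    rw [upperFn_of_bot hμ hν hμν hv hq] at h2
    exact not_top_lt h2
  | top =>
    have := eq_zero_of_quantile_eq_top hv.1 hq
    linarith [hu.1]
  | coe q =>
    obtain ⟨a, haS, -, ha⟩ := exists_contact_of_lowerFn_lt (huv.trans_le hv.2) h1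
    have hqS := quantile_le_upperFn (μ := μ) (ν := ν) v
    rw [hq] at hqS
    obtain ⟨s, hs⟩ : ∃ s : ℝ, upperFn μ ν v = s := by
      induction hS : upperFn μ ν v with
      | bot => rw [hS] at haS; exact absurd haS not_lt_bot
      | top => rw [hS] at h2; exact absurd h2 not_top_lt
      | coe s => exact ⟨s, rfl⟩
    rw [hs] at haS hqS h2
    rw [EReal.coe_le_coe_iff] at hqS
    rw [EReal.coe_lt_coe_iff] at haS
    obtain ⟨b, hsb, hb⟩ := exists_contact_of_lt_upperFn hμ hν hμν hu ha h2
    obtain ⟨m, c, haff⟩ := calEHull_affine_on_of_contact hμ hν hμν hu hv huv.le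
      (haS.trans hsb) ha hb
    -- in either case the contact set of `𝓔_v^c` reaches to `b`, beyond `S(v)`
    have hbv : calEHull μ ν v b = supportLine μ ν v b := by
      rcases le_or_gt a q with haq | hqa
      · exact contact_of_affine_on hμ hν hμν hv hq haq (hqS.trans_lt hsb) haff b
          ⟨(haS.trans hsb).le, le_rfl⟩
      · have hlt : (a : EReal) < upperFn μ ν v := by rw [hs]; exact EReal.coe_lt_coe_iff.2 haS
        obtain ⟨x, hax, hx⟩ := exists_contact_of_lt_upperFn hμ hν hμν hv
          (calEHull_eq_supportLine_of_coe hq) hlt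
        obtain ⟨m', c', hL, hle⟩ := exists_supportLine_eq hμ hν hμν hv
        have hxs : x ≤ s := by
          rw [← EReal.coe_le_coe_iff, ← hs]
          exact le_upperFn_of_contact (by rw [hq]; exact EReal.coe_le_coe_iff.2 (by linarith)) hx
        have hon := eq_affine_of_contact (convexOn_calEHull hμ hν hμν hv) (hqa.trans hax).le hle
          (by rw [← hL]; exact calEHull_eq_supportLine_of_coe hq) (by rw [← hL]; exact hx)
        have e1 := hon a ⟨hqa.le, hax.le⟩
        have e2 := hon x ⟨(hqa.trans hax).le, le_rfl⟩
        rw [haff a ⟨le_rfl, by linarith⟩] at e1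
        rw [haff x ⟨hax.le, by linarith⟩] at e2
        have hmm : m = m' := by
          have : (m - m') * (x - a) = 0 := by linarith
          rcases mul_eq_zero.1 this with h | h <;> linarith
        subst hmm
        rw [haff b ⟨by linarith, le_rfl⟩, hL]
        linarith
    have := le_upperFn_of_contact (by rw [hq]; exact EReal.coe_le_coe_iff.2 (by linarith)) hbv
    rw [hs, EReal.coe_le_coe_iff] at this
    linarith

/-- If `S(u) = ∞` and `v ≥ u`, then `𝓔_v^c` is affine on `[a, ∞)` for every contact point `a`
of `𝓔_u^c`, so that `ν - S^ν(μ_v)` has no mass beyond `a`. -/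
theorem sSup_remainingSupport_le_lowerFn [IsProbabilityMeasure μ] [IsProbabilityMeasure ν]
    (hμ : FiniteFirstMoment μ) (hν : FiniteFirstMoment ν)
    (hμν : ConvexDecreasingLE μ ν) {u v : ℝ} (hu : u ∈ Icc (0 : ℝ) 1) (hv : v ∈ Icc (0 : ℝ) 1)
    (huv : u ≤ v) (hu1 : u < 1) (hS : upperFn μ ν u = ⊤) :
    sSup (Real.toEReal '' remainingSupport μ ν v) ≤ lowerFn μ ν u := by
  refine le_lowerFn hu1 fun a _ ha => ?_
  have haff : ∀ y, a < y → ∃ m c : ℝ, ∀ x ∈ Icc a y, calEHull μ ν v x = m * x + c := by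
    intro y hy
    obtain ⟨b, hyb, hb⟩ := exists_contact_of_lt_upperFn hμ hν hμν hu (x := y) ha
      (by rw [hS]; exact EReal.coe_lt_top y)
    obtain ⟨m, c, h⟩ := calEHull_affine_on_of_contact hμ hν hμν hu hv huv (hy.trans hyb) ha hb
    exact ⟨m, c, fun x hx => h x ⟨hx.1, hx.2.trans hyb.le⟩⟩
  obtain ⟨m, c, h⟩ := haff (a + 1) (by linarith)
  refine sSup_remainingSupport_le_of_affine hμ hν hμν hv (m := m) (c := c) fun y hy => ?_
  obtain ⟨m', c', h'⟩ := haff (max y (a + 1)) (lt_of_lt_of_le (by linarith) (le_max_right _ _))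
  have e1 := h a ⟨le_rfl, by linarith⟩
  have e2 := h (a + 1) ⟨by linarith, le_rfl⟩
  rw [h' a ⟨le_rfl, hy.trans (le_max_left _ _)⟩] at e1
  rw [h' (a + 1) ⟨by linarith, le_max_right _ _⟩] at e2
  have hm : m' = m := by linarith
  subst hm
  rw [h' y ⟨hy, le_max_left _ _⟩]
  linarith

/-- Beyond the support of `ν - S^ν(μ_u)` the hull `𝓔_u^c` is constant, hence in contact with its
support line. -/
theorem lowerFn_le_sSup_remainingSupport [IsProbabilityMeasure μ] [IsProbabilityMeasure ν]
    (hμ : FiniteFirstMoment μ) (hν : FiniteFirstMoment ν)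
    (hμν : ConvexDecreasingLE μ ν) {u : ℝ} (hu : u ∈ Icc (0 : ℝ) 1) :
    lowerFn μ ν u ≤ sSup (Real.toEReal '' remainingSupport μ ν u) := by
  by_contra! hlt
  obtain ⟨x, hTx, hxR⟩ := EReal.lt_iff_exists_real_btwn.1 hlt
  obtain ⟨c, hc⟩ := exists_calEHull_eq_const hμ hν hμν hu hTx.le
  have hxq := hxR.le.trans (lowerFn_le_quantile (μ := μ) (ν := ν) u)
  refine absurd hxR (not_lt.2 (lowerFn_le_of_contact hxq ?_))
  induction hq : quantile μ (1 - u) with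
  | bot => rw [hq, le_bot_iff] at hxq; exact absurd hxq (EReal.coe_ne_bot x)
  | top =>
    have hlim : Tendsto (calEHull μ ν u) atTop (nhds c) := by
      refine tendsto_const_nhds.congr' ?_
      filter_upwards [eventually_ge_atTop x] with y hy
      exact (hc y hy).symm
    rw [supportLine, if_pos hq, hlim.limUnder_eq, hc x le_rfl]
  | coe q =>
    rw [hq, EReal.coe_le_coe_iff] at hxq
    refine contact_of_affine_on hμ hν hμν hu hq hxq (show q < q + 1 by linarith) (m := 0) (c := c)
      (fun y hy => by rw [hc y hy.1]; ring) x ⟨le_rfl, by linarith⟩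

end Bounds

end ShadowCoupling

theorem proposition5p3 (μ ν : Measure ℝ) [IsProbabilityMeasure μ] [IsProbabilityMeasure ν]
    (hμ : Integrable (fun x : ℝ => x) μ) (hν : Integrable (fun x : ℝ => x) ν)
    (hμν : ShadowCoupling.ConvexDecreasingLE μ ν) :
    (∀ u ∈ Icc (0 : ℝ) 1,
      ShadowCoupling.lowerFn μ ν u ≤ ShadowCoupling.quantile μ (1 - u) ∧
        ShadowCoupling.quantile μ (1 - u) ≤ ShadowCoupling.upperFn μ ν u) ∧
    AntitoneOn (ShadowCoupling.lowerFn μ ν) (Icc (0 : ℝ) 1) ∧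
    (∀ u ∈ Icc (0 : ℝ) 1, ∀ v ∈ Icc (0 : ℝ) 1, u < v →
      ShadowCoupling.upperFn μ ν v ∉
        Ioo (ShadowCoupling.lowerFn μ ν u) (ShadowCoupling.upperFn μ ν u)) ∧
    (∀ u ∈ Icc (0 : ℝ) 1, ∀ v ∈ Icc (0 : ℝ) 1, u < v →
      ShadowCoupling.upperFn μ ν u = ⊤ →
        sSup (Real.toEReal '' ShadowCoupling.remainingSupport μ ν v) ≤
            sSup (Real.toEReal '' ShadowCoupling.remainingSupport μ ν u) ∧
          sSup (Real.toEReal '' ShadowCoupling.remainingSupport μ ν u) =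
            ShadowCoupling.lowerFn μ ν u) := by
  have hμ' : ShadowCoupling.FiniteFirstMoment μ := ⟨inferInstance, hμ⟩
  have hν' : ShadowCoupling.FiniteFirstMoment ν := ⟨inferInstance, hν⟩
  refine ⟨fun u _ => ⟨ShadowCoupling.lowerFn_le_quantile u, ShadowCoupling.quantile_le_upperFn u⟩,
    ShadowCoupling.lowerFn_antitoneOn hμ' hν' hμν,
    fun u hu v hv huv => ShadowCoupling.upperFn_notMem_Ioo hμ' hν' hμν hu hv huv,
    fun u hu v hv huv hS => ?_⟩
  have hu1 : u < 1 := huv.trans_le hv.2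
  have heq : sSup (Real.toEReal '' ShadowCoupling.remainingSupport μ ν u) =
      ShadowCoupling.lowerFn μ ν u :=
    le_antisymm
      (ShadowCoupling.sSup_remainingSupport_le_lowerFn hμ' hν' hμν hu hu le_rfl hu1 hS)
      (ShadowCoupling.lowerFn_le_sSup_remainingSupport hμ' hν' hμν hu)
  refine ⟨?_, heq⟩
  rw [heq]
  exact ShadowCoupling.sSup_remainingSupport_le_lowerFn hμ' hν' hμν hu hv huv.le hu1 hS
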